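/- **Theorem 3.1.** Let $d, m, k \geq 1$ be integers, let $K = \prod_{i=1}^d [u_i, v_i] \subset \mathbb{R}^d$ be a closed rectangle with $u_i < v_i$ for all $i$, and let $f : K \to \mathbb{R}^m$ be of class $C^2$ (derivatives at boundary points of $K$ being taken within $K$). Suppose that for every $\alpha \in K$ and every $t \in \mathbb{R}^m \setminus \{0\}$, the $d \times d$ matrix $\big(t \cdot f''(\alpha)[e_i, e_j]\big)_{1 \le i,j \le d}$ has rank at least $k$, where $e_1,\dots,e_d$ is the standard basis of $\mathbb{R}^d$. For an integer $q \geq 1$, a real $\kappa > 0$ and $\theta = (\lambda, \gamma) \in \mathbb{R}^d \times \mathbb{R}^m$, let $A(q,\kappa,\theta)$ be the number of pairs $(a,b) \in \mathbb{Z}^d \times \mathbb{Z}^m$ such that $$\frac{a+\lambda}{q} \in K \quad\text{and}\quad \left| f\!\left(\frac{a+\lambda}{q}\right) - \frac{b+\gamma}{q} \right| < \frac{\kappa}{q},$$ where $|\cdot|$ is the max norm on $\mathbb{R}^m$. Then there is a constant $C \geq 1$, depending only on $d$, $m$, $k$, $K$ and $f$, such that for all integers $q \geq 1$, all $\kappa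 > 0$ and all $\theta \in \mathbb{R}^{d} \times \mathbb{R}^m$, the number $A(q,\kappa,\theta)$ is finite and $$A(q,\kappa,\theta) \leq C\, q^d \max\big(\kappa, \phi(q)\big)^m, \qquad \phi(q) = \big(q^{-1} \operatorname{Log}^2(q)\big)^{\frac{k}{2m+k}}, \qquad \operatorname{Log}(q) = \max(1, \log q).$$ -/

import Mathlib

noncomputable section

namespace RationalPoints

/-- The modified logarithm `Log x = max (1, log x)`. -/
def Log (x : ℝ) : ℝ := max 1 (Real.log x)

/-- `φ(q) = (q⁻¹ Log² q) ^ (k / (2m + k))`. -/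
def phi (m k q : ℕ) : ℝ :=
  ((q : ℝ)⁻¹ * Log (q : ℝ) ^ 2) ^ ((k : ℝ) / (2 * (m : ℝ) + (k : ℝ)))

/-- The second derivative `f''(α)[u, v]`, where derivatives are taken within the set `K`
(so that they are one-sided at boundary points of a rectangle). -/
def secondDeriv {d m : ℕ} (K : Set (Fin d → ℝ)) (f : (Fin d → ℝ) → (Fin m → ℝ))
    (α u v : Fin d → ℝ) : Fin m → ℝ :=
  fderivWithin ℝ (fderivWithin ℝ f K) K α u v

/-- The `d × d` matrix `(t · f''(α)[eᵢ, eⱼ])`, with `eᵢ` the standard basis of `ℝᵈ`. -/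
def hessian {d m : ℕ} (K : Set (Fin d → ℝ)) (f : (Fin d → ℝ) → (Fin m → ℝ))
    (α : Fin d → ℝ) (t : Fin m → ℝ) : Matrix (Fin d) (Fin d) ℝ :=
  Matrix.of fun i j => t ⬝ᵥ secondDeriv K f α (Pi.single i 1) (Pi.single j 1)

/-- The set of all `(a, b) ∈ ℤᵈ × ℤᵐ` with `(a + lam)/q ∈ K` and
`|f((a + lam)/q) - (b + γ)/q| < κ/q`, where `θ = (lam, γ)`. The norm on `Fin m → ℝ` is the
max norm. -/
def countingSet {d m : ℕ} (K : Set (Fin d → ℝ)) (f : (Fin d → ℝ) → (Fin m → ℝ))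
    (q : ℕ) (κ : ℝ) (θ : (Fin d → ℝ) × (Fin m → ℝ)) : Set ((Fin d → ℤ) × (Fin m → ℤ)) :=
  {p | (fun i => ((p.1 i : ℝ) + θ.1 i) / (q : ℝ)) ∈ K ∧
    ‖f (fun i => ((p.1 i : ℝ) + θ.1 i) / (q : ℝ)) -
      (fun j => ((p.2 j : ℝ) + θ.2 j) / (q : ℝ))‖ < κ / (q : ℝ)}

end RationalPoints

end

namespace RationalPoints

open Finset

/-! Enlarging `κ` to `max κ (φ q)` only adds points. If `κ` is bounded below, counting every `a` and
every admissible `b` suffices. Otherwise average over boxes of side `B ≈ √(κq)`: on such a box `q f`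
is affine up to `O(κ)`, so the task is to count the `y` in a box at which an affine map is within
`O(κ)` of an integer point. Exponential sums of length `N ≈ 1/κ` detect this
(`card_affine_near_int_le`). Opening the square gives, for `h = n - n'`, products over `i` of linear
sums of length `B` with frequencies `∂ᵢ(h · f)`. The diagonal `h = 0` contributes a relative `N⁻ᵐ`.
For `h ≠ 0` the rank hypothesis enters: locally, `k` of the partial derivatives of `h · f` separate
points differing in `k` suitable coordinates, with constants uniform by compactness
(`exists_gradient_lower_bound`). Hence these `k` frequencies are spread among the bins of length
`1/B` modulo 1, and averaging over base points saves `(log B / B) ^ k`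
(`exists_sum_prod_expSum_grad_le`). The exponent in `φ` makes this saving at least as good as `κᵐ`.
-/

/-! ### Linear algebra: quantitative injectivity from a rank bound -/

lemma exists_linearIndependent_rows {n p : Type*} [Fintype n] [Fintype p]
    (A : Matrix n p ℝ) {k : ℕ} (h : k ≤ A.rank) :
    ∃ a : Fin k → n, Function.Injective a ∧ LinearIndependent ℝ (fun i => A (a i)) := by
  obtain ⟨κ, a, ha, hsp, hli⟩ := exists_linearIndependent' ℝ A.row
  have : Finite κ := Finite.of_injective a ha
  have := Fintype.ofFinite κ
  have hc : Fintype.card κ = A.rank := by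
    rw [Matrix.rank_eq_finrank_span_row, ← hsp]
    exact (finrank_span_eq_card hli).symm
  obtain ⟨e⟩ : Nonempty (Fin k ↪ κ) :=
    Function.Embedding.nonempty_of_card_le (by simpa [hc] using h)
  exact ⟨a ∘ e, ha.comp e.injective, hli.comp e e.injective⟩

/-- A matrix of rank at least `k` has a `k × k` submatrix which is injective, quantitatively. -/
lemma exists_submatrix_lower_bound {d k : ℕ} (hk : 0 < k) (A : Matrix (Fin d) (Fin d) ℝ)
    (h : k ≤ A.rank) :
    ∃ I J : Finset (Fin d), #I = k ∧ #J = k ∧ ∃ c : ℝ, 0 < c ∧ ∀ v : Fin d → ℝ,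
      (∀ i, i ∉ J → v i = 0) → ∃ i ∈ I, c * ‖v‖ ≤ |(A.mulVec v) i| := by
  obtain ⟨a, ha, hla⟩ := exists_linearIndependent_rows A h
  have hr : k ≤ ((A.submatrix a id).transpose).rank := by
    rw [Matrix.rank_transpose]
    have : LinearIndependent ℝ (A.submatrix a id).row := hla
    rw [this.rank_matrix, Fintype.card_fin]
  obtain ⟨b, hb, hlb⟩ := exists_linearIndependent_rows _ hr
  let I := univ.image a
  let J := univ.image b
  have hI : #I = k := by rw [card_image_of_injective _ ha]; simp
  have hJ : #J = k := by rw [card_image_of_injective _ hb]; simp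
  have key : ∀ v : Fin d → ℝ, (∀ i, i ∉ J → v i = 0) → (∀ i ∈ I, (A.mulVec v) i = 0) →
      v = 0 := by
    intro v hv hA
    have h0 : ∀ i, v (b i) = 0 := by
      refine Fintype.linearIndependent_iff.mp hlb (fun i => v (b i)) ?_
      ext j
      have := hA (a j) (mem_image_of_mem _ (mem_univ _))
      rw [Matrix.mulVec, dotProduct,
        ← sum_subset (subset_univ J) (fun i _ hi => by rw [hv i hi, mul_zero]),
        sum_image hb.injOn] at this
      simpa [mul_comm] using this
    ext i
    by_cases hi : i ∈ J
    · obtain ⟨j, -, rfl⟩ := mem_image.mp hi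
      exact h0 j
    · exact hv i hi
  -- `Φ` pairs the rows `I` of `A v` with the coordinates of `v` off `J`. By `key` it is injective
  -- on the whole space, hence antilipschitz; its second component vanishes for `v` supported on
  -- `J`.
  let Φ : (Fin d → ℝ) →ₗ[ℝ] (Fin d → ℝ) × (Fin d → ℝ) :=
    { toFun := fun v => (fun i => if i ∈ I then (A.mulVec v) i else 0,
        fun i => if i ∈ J then 0 else v i)
      map_add' := by
        intro v w
        ext i <;> simp [Matrix.mulVec_add] <;> split_ifs <;> simp
      map_smul' := by
        intro r v
        ext i <;> simp [Matrix.mulVec_smul] }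
  have hker : LinearMap.ker Φ = ⊥ := by
    rw [LinearMap.ker_eq_bot']
    intro v hv
    have h1 := congrArg Prod.fst hv
    have h2 := congrArg Prod.snd hv
    refine key v (fun i hi => ?_) (fun i hi => ?_)
    · simpa [Φ, hi] using congrFun h2 i
    · simpa [Φ, hi] using congrFun h1 i
  obtain ⟨K, hK, hanti⟩ := Φ.exists_antilipschitzWith hker
  have hKpos : (0 : ℝ) < K := hK
  refine ⟨I, J, hI, hJ, (K : ℝ)⁻¹, by positivity, fun v hv => ?_⟩
  have hle : ‖v‖ ≤ K * ‖Φ v‖ := by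
    simpa using hanti.le_mul_dist v 0
  have hIne : I.Nonempty := by
    rw [← card_pos, hI]; exact hk
  by_contra! hcon
  obtain ⟨i0, hi0⟩ := hIne
  have hpos : 0 < (K : ℝ)⁻¹ * ‖v‖ := (abs_nonneg _).trans_lt (hcon i0 hi0)
  have h2 : (Φ v).2 = 0 := by
    ext i
    by_cases hi : i ∈ J <;> simp [Φ, hi]
    exact hv i hi
  have h1 : ‖(Φ v).1‖ < (K : ℝ)⁻¹ * ‖v‖ := by
    rw [pi_norm_lt_iff hpos]
    intro i
    by_cases hi : i ∈ I
    · simpa [Φ, hi] using hcon i hi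
    · simpa [Φ, hi] using hpos
  have h3 : ‖Φ v‖ < (K : ℝ)⁻¹ * ‖v‖ := by
    rw [Prod.norm_def, h2, norm_zero]
    exact max_lt h1 hpos
  have : K * ‖Φ v‖ < ‖v‖ := by
    calc K * ‖Φ v‖ < K * ((K : ℝ)⁻¹ * ‖v‖) := by gcongr
      _ = ‖v‖ := by field_simp
  linarith

lemma abs_dotProduct_le {m : ℕ} (t w : Fin m → ℝ) : |t ⬝ᵥ w| ≤ m * ‖t‖ * ‖w‖ := by
  calc |t ⬝ᵥ w| ≤ ∑ i, |t i * w i| := abs_sum_le_sum_abs _ _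
    _ ≤ ∑ _i : Fin m, ‖t‖ * ‖w‖ := by
        gcongr with i
        rw [abs_mul]
        exact mul_le_mul (norm_le_pi_norm t i) (norm_le_pi_norm w i) (abs_nonneg _) (norm_nonneg _)
    _ = m * ‖t‖ * ‖w‖ := by simp [mul_assoc]

/-! ### Gradients of `t · f` and Taylor estimates -/

section Analysis

variable {d m : ℕ} {K : Set (Fin d → ℝ)} {f : (Fin d → ℝ) → (Fin m → ℝ)}

/-- `∂ᵢ (t · f)` at `x`. -/
noncomputable def grad (K : Set (Fin d → ℝ)) (f : (Fin d → ℝ) → (Fin m → ℝ)) (t : Fin m → ℝ)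
    (x : Fin d → ℝ) (i : Fin d) : ℝ :=
  t ⬝ᵥ fderivWithin ℝ f K x (Pi.single i 1)

lemma grad_smul (s : ℝ) (t : Fin m → ℝ) (x : Fin d → ℝ) (i : Fin d) :
    grad K f (s • t) x i = s * grad K f t x i := by
  simp [grad]

/-- The transpose puts `v` in the slot along which `fderivWithin ℝ f K` is differentiated, so
symmetry of the second derivative is never needed. -/
lemma hessian_transpose_mulVec (p : Fin d → ℝ) (t : Fin m → ℝ) (v : Fin d → ℝ) (i : Fin d) :
    ((hessian K f p t).transpose.mulVec v) i =
      t ⬝ᵥ fderivWithin ℝ (fderivWithin ℝ f K) K p v (Pi.single i 1) := by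
  have hv : v = ∑ j, v j • (Pi.single j 1 : Fin d → ℝ) := by
    ext l; simp [Finset.sum_apply, Pi.single_apply]
  conv_rhs => rw [hv]
  simp [Matrix.mulVec, dotProduct, hessian, secondDeriv, Finset.mul_sum,
    Finset.sum_apply, mul_comm, mul_left_comm]
  rw [Finset.sum_comm]

/-- Quantitative local injectivity of the partial gradient of `t · f`, near a point. -/
lemma exists_local_gradient_lower_bound {k : ℕ} (hk : 0 < k) (hK : UniqueDiffOn ℝ K)
    (hconv : Convex ℝ K) (hf : ContDiffOn ℝ 2 f K) {p₀ : Fin d → ℝ} (hp₀ : p₀ ∈ K)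
    (t₀ : Fin m → ℝ) (hrank : k ≤ (hessian K f p₀ t₀).rank) :
    ∃ c r : ℝ, 0 < c ∧ 0 < r ∧ ∃ I J : Finset (Fin d), #I = k ∧ #J = k ∧
      ∀ t : Fin m → ℝ, ‖t - t₀‖ < r → ∀ x ∈ K, ∀ x' ∈ K, ‖x - p₀‖ < r → ‖x' - p₀‖ < r →
        (∀ i, i ∉ J → x i = x' i) →
        ∃ i ∈ I, c * ‖x - x'‖ ≤ |grad K f t x i - grad K f t x' i| := by
  rw [← Matrix.rank_transpose] at hrank
  obtain ⟨I, J, hI, hJ, c, hc, hlow⟩ := exists_submatrix_lower_bound hk _ hrank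
  set g := fderivWithin ℝ f K with hg
  have hgC : ContDiffOn ℝ 1 g K := hf.fderivWithin hK (by norm_num)
  have hgd : DifferentiableOn ℝ g K := hgC.differentiableOn (by norm_num)
  have hg' : ContinuousOn (fderivWithin ℝ g K) K := hgC.continuousOn_fderivWithin hK (by norm_num)
  set G := ‖fderivWithin ℝ g K p₀‖ with hG
  -- Two errors must be absorbed by `c`: the oscillation of the second derivative near `p₀`, and the
  -- replacement of `t₀` by `t`. Together they cost at most `c / 4`; the `min` with 1 gives `‖t‖ ≤
  -- ‖t₀‖ + 1`.
  set ε : ℝ := min 1 (c / (4 * (m * (‖t₀‖ + 1 + G) + 1))) with hε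
  have hm0 : (0 : ℝ) ≤ m := Nat.cast_nonneg m
  have hG0 : 0 ≤ G := norm_nonneg (fderivWithin ℝ g K p₀)
  have hεpos : 0 < ε := lt_min one_pos (by positivity)
  obtain ⟨r, hr, hball⟩ := (Metric.continuousOn_iff (f := fderivWithin ℝ g K)).mp hg' p₀ hp₀ ε hεpos
  refine ⟨c / 2, min r ε, by positivity, lt_min hr hεpos, I, J, hI, hJ, ?_⟩
  intro t ht x hx x' hx' hxr hx'r hxx
  obtain ⟨i, hi, hle⟩ := hlow (x - x') (fun i hi => by simp [hxx i hi])
  refine ⟨i, hi, ?_⟩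
  rw [hessian_transpose_mulVec, ← hg] at hle
  set D := fderivWithin ℝ g K p₀
  set e : Fin d → ℝ := Pi.single i 1
  have he : ‖e‖ = 1 := by simp [e, Pi.norm_single]
  have hmv : ‖g x - g x' - D (x - x')‖ ≤ ε * ‖x - x'‖ := by
    have hsub : DifferentiableOn ℝ g (K ∩ Metric.ball p₀ r) := hgd.mono Set.inter_subset_left
    refine (hconv.inter (convex_ball p₀ r)).norm_image_sub_le_of_norm_hasFDerivWithin_le'
      (f' := fderivWithin ℝ g K)
      (fun y hy => ((hgd y hy.1).hasFDerivWithinAt).mono Set.inter_subset_left)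
      (fun y hy => ?_) ⟨hx', ?_⟩ ⟨hx, ?_⟩
    · rw [← dist_eq_norm]; exact (hball y hy.1 hy.2).le
    · rw [mem_ball_iff_norm]; exact hx'r.trans_le (min_le_left _ _)
    · rw [mem_ball_iff_norm]; exact hxr.trans_le (min_le_left _ _)
  have hsplit : t₀ ⬝ᵥ D (x - x') e = (grad K f t x i - grad K f t x' i)
      - t ⬝ᵥ ((g x - g x' - D (x - x')) e) - (t - t₀) ⬝ᵥ D (x - x') e := by
    simp only [grad, ← hg, _root_.sub_apply, dotProduct_sub, sub_dotProduct, map_sub]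
    simp only [e]
    ring
  have htn : ‖t‖ ≤ ‖t₀‖ + 1 := by
    have : ‖t‖ ≤ ‖t - t₀‖ + ‖t₀‖ := by simpa using norm_add_le (t - t₀) t₀
    have h1 : min r ε ≤ 1 := (min_le_right _ _).trans (min_le_left _ _)
    linarith
  have hb1 : |t ⬝ᵥ ((g x - g x' - D (x - x')) e)| ≤ m * (‖t₀‖ + 1) * (ε * ‖x - x'‖) := by
    refine (abs_dotProduct_le _ _).trans ?_
    gcongr
    refine (ContinuousLinearMap.le_opNorm _ _).trans ?_
    rw [he, mul_one]
    exact hmv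
  have hb2 : |(t - t₀) ⬝ᵥ D (x - x') e| ≤ m * ε * (G * ‖x - x'‖) := by
    refine (abs_dotProduct_le _ _).trans ?_
    gcongr
    · exact ht.le.trans (min_le_right _ _)
    · refine (ContinuousLinearMap.le_opNorm _ _).trans ?_
      rw [he, mul_one]
      exact ContinuousLinearMap.le_opNorm _ _
  have hεc : ε * (m * (‖t₀‖ + 1 + G)) ≤ c / 4 := by
    have h1 : ε ≤ c / (4 * (m * (‖t₀‖ + 1 + G) + 1)) := min_le_right _ _
    calc ε * (m * (‖t₀‖ + 1 + G)) ≤ c / (4 * (m * (‖t₀‖ + 1 + G) + 1)) *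
          (m * (‖t₀‖ + 1 + G) + 1) := by gcongr; linarith
      _ = c / 4 := by field_simp
  have hxn := norm_nonneg (x - x')
  have h3 : |t₀ ⬝ᵥ D (x - x') e| ≤ |grad K f t x i - grad K f t x' i| +
      m * (‖t₀‖ + 1) * (ε * ‖x - x'‖) + m * ε * (G * ‖x - x'‖) := by
    rw [hsplit]
    refine (abs_sub _ _).trans (add_le_add ((abs_sub _ _).trans (add_le_add le_rfl hb1)) hb2)
  have h4 := mul_le_mul_of_nonneg_right hεc hxn
  nlinarith

/-- Quantitative local injectivity of the partial gradients of `t · f`, uniformly in `t`. -/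
lemma exists_gradient_lower_bound {k : ℕ} (hk : 0 < k) (hK : UniqueDiffOn ℝ K)
    (hconv : Convex ℝ K) (hcpt : IsCompact K) (hf : ContDiffOn ℝ 2 f K)
    (hrank : ∀ p ∈ K, ∀ t : Fin m → ℝ, t ≠ 0 → k ≤ (hessian K f p t).rank) :
    ∃ c r : ℝ, 0 < c ∧ 0 < r ∧ ∀ p ∈ K, ∀ t : Fin m → ℝ, t ≠ 0 →
      ∃ I J : Finset (Fin d), #I = k ∧ #J = k ∧
        ∀ x ∈ K, ∀ x' ∈ K, ‖x - p‖ < r → ‖x' - p‖ < r → (∀ i, i ∉ J → x i = x' i) →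
        ∃ i ∈ I, c * ‖t‖ * ‖x - x'‖ ≤ |grad K f t x i - grad K f t x' i| := by
  -- Only `c` and `r` have to be uniform. Since `I` and `J` may vary with `z`, the property survives
  -- finite unions, and local validity suffices on a compact set.
  let P : Set ((Fin d → ℝ) × (Fin m → ℝ)) → Prop := fun S =>
    ∃ c r : ℝ, 0 < c ∧ 0 < r ∧ ∀ z ∈ S, ∃ I J : Finset (Fin d), #I = k ∧ #J = k ∧
        ∀ x ∈ K, ∀ x' ∈ K, ‖x - z.1‖ < r → ‖x' - z.1‖ < r → (∀ i, i ∉ J → x i = x' i) →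
        ∃ i ∈ I, c * ‖x - x'‖ ≤ |grad K f z.2 x i - grad K f z.2 x' i|
  have hP : P (K ×ˢ Metric.sphere (0 : Fin m → ℝ) 1) := by
    refine (hcpt.prod (isCompact_sphere 0 1)).induction_on (p := P) ?_ ?_ ?_ ?_
    · exact ⟨1, 1, one_pos, one_pos, by simp⟩
    · rintro S T hST ⟨c, r, hc, hr, h⟩
      exact ⟨c, r, hc, hr, fun z hz => h z (hST hz)⟩
    · rintro S T ⟨c, r, hc, hr, h⟩ ⟨c', r', hc', hr', h'⟩
      refine ⟨min c c', min r r', lt_min hc hc', lt_min hr hr', ?_⟩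
      rintro z (hz | hz)
      · obtain ⟨I, J, hI, hJ, hx⟩ := h z hz
        refine ⟨I, J, hI, hJ, fun x hxK x' hxK' h1 h2 h3 => ?_⟩
        obtain ⟨i, hi, hle⟩ := hx x hxK x' hxK' (h1.trans_le (min_le_left _ _))
          (h2.trans_le (min_le_left _ _)) h3
        exact ⟨i, hi, le_trans (by gcongr; exact min_le_left _ _) hle⟩
      · obtain ⟨I, J, hI, hJ, hx⟩ := h' z hz
        refine ⟨I, J, hI, hJ, fun x hxK x' hxK' h1 h2 h3 => ?_⟩
        obtain ⟨i, hi, hle⟩ := hx x hxK x' hxK' (h1.trans_le (min_le_right _ _))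
          (h2.trans_le (min_le_right _ _)) h3
        exact ⟨i, hi, le_trans (by gcongr; exact min_le_right _ _) hle⟩
    · rintro ⟨p₀, t₀⟩ ⟨hp₀, ht₀⟩
      have ht₀' : t₀ ≠ 0 := by
        rintro rfl
        simp at ht₀
      obtain ⟨c, r, hc, hr, I, J, hI, hJ, h⟩ :=
        exists_local_gradient_lower_bound hk hK hconv hf hp₀ t₀ (hrank p₀ hp₀ t₀ ht₀')
      refine ⟨Metric.ball (p₀, t₀) (r / 2),
        mem_nhdsWithin_of_mem_nhds (Metric.ball_mem_nhds _ (by positivity)),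
        c, r / 2, hc, by positivity, ?_⟩
      rintro ⟨p, t⟩ hz
      rw [mem_ball_iff_norm, Prod.norm_def, max_lt_iff] at hz
      have hzp : ‖p - p₀‖ < r / 2 := hz.1
      have hzt : ‖t - t₀‖ < r / 2 := hz.2
      refine ⟨I, J, hI, hJ, fun x hxK x' hxK' h1 h2 h3 => ?_⟩
      refine h t (by linarith) x hxK x' hxK' ?_ ?_ h3
      · have := norm_sub_le_norm_sub_add_norm_sub x p p₀
        simp only at h1
        linarith
      · have := norm_sub_le_norm_sub_add_norm_sub x' p p₀
        simp only at h2
        linarith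
  obtain ⟨c, r, hc, hr, h⟩ := hP
  refine ⟨c, r, hc, hr, fun p hp t ht => ?_⟩
  have htn : 0 < ‖t‖ := norm_pos_iff.mpr ht
  -- The gradient is linear in `t`, so the unit sphere suffices.
  obtain ⟨I, J, hI, hJ, hx⟩ := h (p, ‖t‖⁻¹ • t) ⟨hp, by simp [norm_smul, htn.ne']⟩
  refine ⟨I, J, hI, hJ, fun x hxK x' hxK' h1 h2 h3 => ?_⟩
  obtain ⟨i, hi, hle⟩ := hx x hxK x' hxK' h1 h2 h3
  refine ⟨i, hi, ?_⟩
  simp only [grad_smul] at hle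
  rw [← mul_sub, abs_mul, abs_of_pos (inv_pos.mpr htn)] at hle
  calc c * ‖t‖ * ‖x - x'‖ = ‖t‖ * (c * ‖x - x'‖) := by ring
    _ ≤ ‖t‖ * (‖t‖⁻¹ * |grad K f t x i - grad K f t x' i|) := by gcongr
    _ = _ := by field_simp

/-- First and second order bounds for a `C²` function on a compact convex set. -/
lemma exists_taylor_bound (hK : UniqueDiffOn ℝ K)
    (hconv : Convex ℝ K) (hcpt : IsCompact K) (hf : ContDiffOn ℝ 2 f K) :
    ∃ L : ℝ, 1 ≤ L ∧ (∀ x ∈ K, ‖fderivWithin ℝ f K x‖ ≤ L) ∧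
      ∀ x ∈ K, ∀ y ∈ K, ‖f y - f x - fderivWithin ℝ f K x (y - x)‖ ≤ L * ‖y - x‖ ^ 2 := by
  set g := fderivWithin ℝ f K with hg
  have hgC : ContDiffOn ℝ 1 g K := hf.fderivWithin hK (by norm_num)
  have hgd : DifferentiableOn ℝ g K := hgC.differentiableOn (by norm_num)
  have hg' : ContinuousOn (fderivWithin ℝ g K) K := hgC.continuousOn_fderivWithin hK (by norm_num)
  have hfd : DifferentiableOn ℝ f K := hf.differentiableOn (by norm_num)
  obtain ⟨L₁, hL₁⟩ := hcpt.exists_bound_of_continuousOn hgC.continuousOn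
  obtain ⟨L₂, hL₂⟩ := hcpt.exists_bound_of_continuousOn (f := fderivWithin ℝ g K) hg'
  refine ⟨max 1 (max L₁ L₂), le_max_left _ _,
    fun x hx => (hL₁ x hx).trans ((le_max_left _ _).trans (le_max_right _ _)), ?_⟩
  intro x hx y hy
  have hL2 : L₂ ≤ max 1 (max L₁ L₂) := (le_max_right _ _).trans (le_max_right _ _)
  have hL0 : 0 ≤ L₂ := (norm_nonneg _).trans (hL₂ x hx)
  have hseg : segment ℝ x y ⊆ K := hconv.segment_subset hx hy
  -- The mean value inequality is used twice: for `g` along the segment, then for `f` minus its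
  -- linearization at `x`.
  have := (convex_segment x y).norm_image_sub_le_of_norm_hasFDerivWithin_le' (f := f)
    (f' := g) (φ := g x) (C := L₂ * ‖y - x‖)
    (fun z hz => ((hfd z (hseg hz)).hasFDerivWithinAt).mono hseg)
    (fun z hz => by
      refine (hconv.norm_image_sub_le_of_norm_fderivWithin_le hgd hL₂ hx (hseg hz)).trans ?_
      gcongr
      exact norm_sub_le_of_mem_segment hz)
    (left_mem_segment ℝ x y) (right_mem_segment ℝ x y)
  calc _ ≤ L₂ * ‖y - x‖ * ‖y - x‖ := this
    _ = L₂ * ‖y - x‖ ^ 2 := by ring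
    _ ≤ _ := by gcongr

end Analysis

/-! ### Linear exponential sums -/

/-- The additive character `x ↦ exp (2πix)`. -/
noncomputable def e (x : ℝ) : ℂ := Complex.exp (Complex.I * (2 * Real.pi * x : ℝ))

lemma e_add (x y : ℝ) : e (x + y) = e x * e y := by
  rw [e, e, e, ← Complex.exp_add]
  push_cast
  ring_nf

lemma norm_e (x : ℝ) : ‖e x‖ = 1 := by
  rw [e, mul_comm, Complex.norm_exp_ofReal_mul_I]

lemma e_int (n : ℤ) : e n = 1 := by
  rw [e, Complex.exp_eq_one_iff]
  exact ⟨n, by push_cast; ring⟩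

lemma e_zero : e 0 = 1 := by simpa using e_int 0

lemma e_add_int (x : ℝ) (n : ℤ) : e (x + n) = e x := by rw [e_add, e_int, mul_one]

lemma e_mul_nat (x : ℝ) (n : ℕ) : e (x * n) = e x ^ n := by
  rw [e, e, ← Complex.exp_nat_mul]
  push_cast
  ring_nf

lemma e_sum {ι : Type*} (s : Finset ι) (x : ι → ℝ) : e (∑ i ∈ s, x i) = ∏ i ∈ s, e (x i) := by
  classical
  induction s using Finset.induction_on with
  | empty => simp [e_zero]
  | insert a s ha ih => rw [sum_insert ha, prod_insert ha, e_add, ih]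

lemma conj_e (x : ℝ) : starRingEnd ℂ (e x) = e (-x) := by
  rw [e, e, ← Complex.exp_conj, map_mul, Complex.conj_I, Complex.conj_ofReal]
  push_cast
  ring_nf

lemma norm_e_sub_one (x : ℝ) : ‖e x - 1‖ = 2 * |Real.sin (Real.pi * x)| := by
  rw [e, Complex.norm_exp_I_mul_ofReal_sub_one, Real.norm_eq_abs, abs_mul, abs_two]
  ring_nf

/-- The linear exponential sum of length `B`. -/
noncomputable def expSum (B : ℕ) (θ : ℝ) : ℂ := ∑ y ∈ range B, e (θ * y)

lemma norm_expSum_le (B : ℕ) (θ : ℝ) : ‖expSum B θ‖ ≤ B := by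
  refine (norm_sum_le _ _).trans ?_
  simp [norm_e]

lemma expSum_zero (B : ℕ) : expSum B 0 = B := by simp [expSum, e_zero]

lemma expSum_add_int (B : ℕ) (θ : ℝ) (n : ℤ) : expSum B (θ + n) = expSum B θ := by
  refine sum_congr rfl fun y _ => ?_
  rw [e_mul_nat, e_mul_nat, e_add_int]

lemma norm_expSum_mul_abs_sin_le (B : ℕ) (θ : ℝ) :
    ‖expSum B θ‖ * |Real.sin (Real.pi * θ)| ≤ 1 := by
  have h : expSum B θ * (e θ - 1) = e θ ^ B - 1 := by
    rw [← geom_sum_mul, expSum]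
    simp only [e_mul_nat]
  have h2 : ‖expSum B θ‖ * (2 * |Real.sin (Real.pi * θ)|) ≤ 2 := by
    rw [← norm_e_sub_one, ← norm_mul, h]
    refine (norm_sub_le _ _).trans ?_
    simp [norm_e]
    norm_num
  linarith

/-- The index of the interval `[j/B, (j+1)/B)` containing the fractional part of `θ`. -/
noncomputable def bin (B : ℕ) (θ : ℝ) : ℕ := ⌊(B : ℝ) * Int.fract θ⌋₊

lemma bin_lt {B : ℕ} (hB : 0 < B) (θ : ℝ) : bin B θ < B := by
  rw [bin, Nat.floor_lt (by have := Int.fract_nonneg θ; positivity)]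
  have : (0 : ℝ) < B := by exact_mod_cast hB
  nlinarith [Int.fract_lt_one θ]

/-- The bound for `expSum B θ` in terms of `bin B θ`. -/
noncomputable def binWeight (B j : ℕ) : ℝ := B / (j + 1) + B / (B - j)

lemma two_mul_le_sin {u : ℝ} (h0 : 0 ≤ u) (h1 : u ≤ 1 / 2) : 2 * u ≤ Real.sin (Real.pi * u) := by
  have hp := Real.pi_pos
  have := Real.mul_le_sin (x := Real.pi * u) (by positivity) (by nlinarith)
  calc 2 * u = 2 / Real.pi * (Real.pi * u) := by field_simp
    _ ≤ _ := this

/-- The geometric sum is at most the inverse of twice the distance from `θ` to the integers. The two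
terms of the weight serve the two halves of the unit interval; in the two extreme bins the trivial
bound `B` takes over. -/
lemma norm_expSum_le_binWeight {B : ℕ} (hB : 0 < B) (θ : ℝ) :
    ‖expSum B θ‖ ≤ binWeight B (bin B θ) := by
  set j := bin B θ with hj
  set u := Int.fract θ with hu
  have hjB : j < B := bin_lt hB θ
  have hB' : (0 : ℝ) < B := by exact_mod_cast hB
  have hu0 : 0 ≤ u := Int.fract_nonneg θ
  have hu1 : u < 1 := Int.fract_lt_one θ
  have hju : (j : ℝ) ≤ B * u := Nat.floor_le (by positivity)
  have huj : B * u < j + 1 := Nat.lt_floor_add_one _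
  have hS : expSum B θ = expSum B u := by
    conv_lhs => rw [← Int.fract_add_floor θ]
    rw [expSum_add_int]
  have htriv := norm_expSum_le B u
  have hsin := norm_expSum_mul_abs_sin_le B u
  rw [hS, binWeight]
  set S := ‖expSum B u‖
  have hS0 : 0 ≤ S := norm_nonneg _
  have hBj : (0 : ℝ) < B - j := by
    have : (j : ℝ) < B := by exact_mod_cast hjB
    linarith
  rcases le_total u (1 / 2) with h | h
  · have h1 := (two_mul_le_sin hu0 h).trans (le_abs_self _)
    have h2 : S * (2 * u) ≤ 1 := (mul_le_mul_of_nonneg_left h1 hS0).trans hsin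
    have h3 : S * (j + 1) ≤ B := by
      rcases Nat.eq_zero_or_pos j with h0 | h0
      · simp [h0, htriv]
      · have : (1 : ℝ) ≤ j := by exact_mod_cast h0
        calc S * (j + 1) ≤ S * (2 * (B * u)) := by gcongr; linarith
          _ = B * (S * (2 * u)) := by ring
          _ ≤ B * 1 := by gcongr
          _ = B := mul_one _
    have h4 : S ≤ B / (j + 1) := by rwa [le_div_iff₀ (by positivity)]
    have : 0 ≤ B / ((B : ℝ) - j) := by positivity
    linarith
  · have h1 := (two_mul_le_sin (u := 1 - u) (by linarith) (by linarith)).trans (le_abs_self _)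
    rw [mul_sub Real.pi, mul_one Real.pi, Real.sin_pi_sub] at h1
    have h2 : S * (2 * 1 - 2 * u) ≤ 1 :=
      (mul_le_mul_of_nonneg_left (by linarith) hS0).trans hsin
    have h3 : S * (B - j) ≤ B := by
      rcases Nat.lt_or_ge (j + 1) B with h0 | h0
      · have : (j : ℝ) + 2 ≤ B := by exact_mod_cast h0
        calc S * (B - j) ≤ S * (B * (2 * 1 - 2 * u)) := by gcongr; nlinarith
          _ = B * (S * (2 * 1 - 2 * u)) := by ring
          _ ≤ B * 1 := by gcongr
          _ = B := mul_one _
      · have : (B : ℝ) ≤ j + 1 := by exact_mod_cast h0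
        nlinarith
    have h4 : S ≤ B / (B - j) := by rwa [le_div_iff₀ hBj]
    have : 0 ≤ (B : ℝ) / (j + 1) := by positivity
    linarith

lemma sum_binWeight_le (B : ℕ) :
    ∑ j ∈ range B, binWeight B j ≤ 2 * B * (1 + Real.log B) := by
  have h1 : ∑ j ∈ range B, (B : ℝ) / (j + 1) ≤ B * (1 + Real.log B) := by
    have := harmonic_le_one_add_log B
    rw [harmonic] at this
    push_cast at this
    simp only [div_eq_mul_inv]
    rw [← mul_sum]
    gcongr
  have h2 : ∑ j ∈ range B, (B : ℝ) / (B - j) = ∑ j ∈ range B, (B : ℝ) / (j + 1) := by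
    rw [← sum_range_reflect]
    refine sum_congr rfl fun j hj => ?_
    rw [mem_range] at hj
    have : ((B - 1 - j : ℕ) : ℝ) = B - 1 - j := by
      rw [Nat.cast_sub (by omega), Nat.cast_sub (by omega), Nat.cast_one]
    rw [this]
    congr 1
    ring
  simp only [binWeight]
  rw [sum_add_distrib, h2]
  linarith

lemma binWeight_nonneg {B j : ℕ} (h : j < B) : 0 ≤ binWeight B j := by
  have : (j : ℝ) < B := by exact_mod_cast h
  have : (0 : ℝ) < B - j := by linarith
  rw [binWeight]
  positivity

/-- All phases stay within `π / 4` of 0, so every term has real part at least `√2 / 2` and nothing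
cancels. -/
lemma sq_div_two_le_norm_expSum_sq {N : ℕ} (x : ℝ) (b : ℤ)
    (h : |x - b| * (8 * N) ≤ 1) : (N : ℝ) ^ 2 / 2 ≤ ‖expSum N x‖ ^ 2 := by
  have hS : expSum N x = expSum N (x - b) := by
    conv_lhs => rw [← sub_add_cancel x b]
    rw [expSum_add_int]
  have hre : √2 / 2 * N ≤ (expSum N (x - b)).re := by
    rw [expSum, Complex.re_sum]
    calc √2 / 2 * N = ∑ _y ∈ range N, √2 / 2 := by simp [mul_comm]
      _ ≤ _ := by
        refine sum_le_sum fun y hy => ?_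
        rw [mem_range] at hy
        have hy' : (y : ℝ) ≤ N := by exact_mod_cast hy.le
        rw [e, mul_comm Complex.I, Complex.exp_ofReal_mul_I_re, ← Real.cos_pi_div_four,
          ← Real.cos_abs (2 * _ * _)]
        have hp := Real.pi_pos
        have habs : |2 * Real.pi * ((x - b) * y)| ≤ Real.pi / 4 := by
          rw [abs_mul, abs_mul (x - b), abs_of_pos (by positivity : 0 < 2 * Real.pi),
            Nat.abs_cast]
          have : |x - b| * y ≤ |x - b| * N := by gcongr
          nlinarith
        exact Real.cos_le_cos_of_nonneg_of_le_pi (abs_nonneg _) (by linarith) habs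
  have h1 : √2 / 2 * N ≤ ‖expSum N x‖ := by
    rw [hS]
    exact hre.trans (Complex.re_le_norm _)
  calc (N : ℝ) ^ 2 / 2 = (√2 / 2 * N) ^ 2 := by
        rw [mul_pow, div_pow, Real.sq_sqrt (by norm_num)]; ring
    _ ≤ _ := by gcongr

/-! ### Detecting near-integer points by exponential sums -/

/-- The cube `[0, N)ᵐ`. -/
def cube (m N : ℕ) : Finset (Fin m → ℕ) := Fintype.piFinset fun _ => range N

lemma card_cube (m N : ℕ) : #(cube m N) = N ^ m := by simp [cube]

lemma sum_cube_e (m N : ℕ) (x : Fin m → ℝ) :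
    ∑ n ∈ cube m N, e (∑ j, x j * n j) = ∏ j, expSum N (x j) := by
  simp only [cube, e_sum, expSum]
  rw [prod_univ_sum]

/-- The number of points of a cube at which an affine map is close to an integer point is bounded
by exponential sums. -/
lemma card_affine_near_int_le {d m B N : ℕ} (S : Finset (Fin d → ℕ)) (hS : S ⊆ cube d B)
    (c : Fin m → ℝ) (A : Fin m → Fin d → ℝ)
    (h : ∀ y ∈ S, ∀ j, ∃ b : ℤ, |c j + ∑ i, A j i * y i - b| * (8 * N) ≤ 1) :
    (#S : ℝ) * ((N : ℝ) ^ 2 / 2) ^ m ≤ ∑ n ∈ cube m N, ∑ n' ∈ cube m N,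
      ∏ i, ‖expSum B (∑ j, ((n j : ℝ) - n' j) * A j i)‖ := by
  let x : (Fin d → ℕ) → Fin m → ℝ := fun y j => c j + ∑ i, A j i * y i
  have h1 : (#S : ℝ) * ((N : ℝ) ^ 2 / 2) ^ m ≤
      ∑ y ∈ cube d B, ‖∑ n ∈ cube m N, e (∑ j, x y j * n j)‖ ^ 2 := by
    calc (#S : ℝ) * ((N : ℝ) ^ 2 / 2) ^ m = ∑ _y ∈ S, ((N : ℝ) ^ 2 / 2) ^ m := by simp
      _ ≤ ∑ y ∈ S, ‖∑ n ∈ cube m N, e (∑ j, x y j * n j)‖ ^ 2 := by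
        refine sum_le_sum fun y hy => ?_
        rw [sum_cube_e, norm_prod, ← prod_pow]
        calc ((N : ℝ) ^ 2 / 2) ^ m = ∏ _j : Fin m, ((N : ℝ) ^ 2 / 2) := by simp [div_pow]
          _ ≤ _ := prod_le_prod (fun _ _ => by positivity) fun j _ => by
            obtain ⟨b, hb⟩ := h y hy j
            exact sq_div_two_le_norm_expSum_sq _ b hb
      _ ≤ _ := sum_le_sum_of_subset_of_nonneg hS fun _ _ _ => by positivity
  -- Opening the square: the constant part `c` contributes only a unimodular factor, and the sum
  -- over `y` factors over the coordinates.
  have h2 : ((∑ y ∈ cube d B, ‖∑ n ∈ cube m N, e (∑ j, x y j * n j)‖ ^ 2 : ℝ) : ℂ) =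
      ∑ n ∈ cube m N, ∑ n' ∈ cube m N,
        e (∑ j, ((n j : ℝ) - n' j) * c j) *
          ∏ i, expSum B (∑ j, ((n j : ℝ) - n' j) * A j i) := by
    push_cast
    simp only [← Complex.mul_conj', map_sum, conj_e, sum_mul_sum, ← e_add, ← sum_cube_e]
    rw [sum_comm]
    refine sum_congr rfl fun n _ => ?_
    rw [sum_comm]
    refine sum_congr rfl fun n' _ => ?_
    rw [mul_sum]
    refine sum_congr rfl fun y _ => ?_
    rw [← e_add]
    congr 1
    simp only [x, sum_mul, add_mul, sum_add_distrib, sub_mul, sum_sub_distrib]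
    rw [sum_comm (f := fun i j => (n j : ℝ) * A j i * y i),
      sum_comm (f := fun i j => (n' j : ℝ) * A j i * y i)]
    simp only [mul_comm, mul_left_comm]
    ring_nf
  refine h1.trans ?_
  rw [← Complex.norm_of_nonneg (show 0 ≤ ∑ y ∈ cube d B,
    ‖∑ n ∈ cube m N, e (∑ j, x y j * n j)‖ ^ 2 by positivity), h2]
  refine (norm_sum_le _ _).trans (sum_le_sum fun n _ => (norm_sum_le _ _).trans
    (sum_le_sum fun n' _ => ?_))
  rw [norm_mul, norm_e, one_mul, norm_prod]

lemma abs_sub_mul_lt_one_of_bin_eq {B : ℕ} {x y : ℝ} (hfl : ⌊x⌋ = ⌊y⌋)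
    (hbin : bin B x = bin B y) : |x - y| * B < 1 := by
  have hB0 : (0 : ℝ) ≤ B := Nat.cast_nonneg B
  have hx0 := mul_nonneg hB0 (Int.fract_nonneg x)
  have hy0 := mul_nonneg hB0 (Int.fract_nonneg y)
  have hx1 := Nat.floor_le hx0
  have hx2 := Nat.lt_floor_add_one ((B : ℝ) * Int.fract x)
  have hy1 := Nat.floor_le hy0
  have hy2 := Nat.lt_floor_add_one ((B : ℝ) * Int.fract y)
  unfold bin at hbin
  rw [hbin] at hx1 hx2
  have hxy : x - y = Int.fract x - Int.fract y := by
    rw [Int.fract, Int.fract, hfl]; ring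
  rw [← abs_of_nonneg hB0, ← abs_mul, hxy, abs_lt]
  constructor <;> nlinarith

/-! ### Distribution of the frequencies among the bins -/

/-- The number of lattice points at which the chosen frequencies lie in prescribed bins. -/
lemma card_bin_fiber_le {d k B M Θ R : ℕ} {I J : Finset (Fin d)} (hI : #I = k) (hJ : #J = k)
    (Λ : Fin d → Finset ℤ) (hΛ : ∀ i, #(Λ i) ≤ M) (T : Finset (Fin d → ℤ))
    (hT : T ⊆ Fintype.piFinset Λ) (θ : (Fin d → ℤ) → Fin d → ℝ)
    (hθ : ∀ a ∈ T, ∀ i ∈ I, |θ a i| ≤ Θ)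
    (hR : ∀ a ∈ T, ∀ a' ∈ T, (∀ i, i ∉ J → a i = a' i) →
      (∀ i ∈ I, |θ a i - θ a' i| * B < 1) → ∀ i, |a i - a' i| ≤ R)
    (j : Fin d → ℕ) :
    #{a ∈ T | ∀ i ∈ I, bin B (θ a i) = j i} ≤
      (2 * R + 1) ^ k * (M ^ (d - k) * (2 * Θ + 1) ^ k) := by
  set U := {a ∈ T | ∀ i ∈ I, bin B (θ a i) = j i} with hU
  -- `F` records the coordinates off `J` and the integer parts of the frequencies in `I`. Within
  -- `U`, points with the same `F` have frequencies closer than `1/B`, so `hR` confines them to a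
  -- cube in the `J` coordinates.
  let F : (Fin d → ℤ) → (Fin d → ℤ) × (Fin d → ℤ) := fun a =>
    (fun i => if i ∈ J then 0 else a i, fun i => if i ∈ I then ⌊θ a i⌋ else 0)
  have himage : #(U.image F) ≤ M ^ (d - k) * (2 * Θ + 1) ^ k := by
    have hsub : U.image F ⊆ (Fintype.piFinset fun i => if i ∈ J then {0} else Λ i) ×ˢ
        (Fintype.piFinset fun i => if i ∈ I then Icc (-(Θ : ℤ)) Θ else {0}) := by
      intro z hz
      obtain ⟨a, ha, rfl⟩ := mem_image.mp hz
      have haT : a ∈ T := (mem_filter.mp ha).1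
      rw [mem_product, Fintype.mem_piFinset, Fintype.mem_piFinset]
      refine ⟨fun i => ?_, fun i => ?_⟩
      · by_cases hi : i ∈ J
        · simp [F, hi]
        · simpa [F, hi] using Fintype.mem_piFinset.mp (hT haT) i
      · by_cases hi : i ∈ I
        · have := abs_le.mp (hθ a haT i hi)
          simp only [F, hi, if_true, mem_Icc]
          refine ⟨Int.le_floor.mpr (by push_cast; exact this.1), ?_⟩
          have h2 := (Int.floor_le (θ a i)).trans this.2
          exact_mod_cast h2
        · simp [F, hi]
    refine (card_le_card hsub).trans ?_
    rw [card_product, Fintype.card_piFinset, Fintype.card_piFinset]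
    gcongr
    · calc ∏ i, #(if i ∈ J then {0} else Λ i) ≤ ∏ i, (if i ∈ J then 1 else M) := by
            refine prod_le_prod' fun i _ => ?_
            split_ifs
            · simp
            · exact hΛ i
        _ = M ^ (d - k) := by
            rw [prod_ite]
            simp [filter_not, card_sdiff, hJ]
    · calc ∏ i, #(if i ∈ I then Icc (-(Θ : ℤ)) Θ else {0})
          ≤ ∏ i, (if i ∈ I then 2 * Θ + 1 else 1) := by
            refine prod_le_prod' fun i _ => ?_
            split_ifs
            · rw [Int.card_Icc]; omega
            · simp
        _ ≤ (2 * Θ + 1) ^ k := by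
            rw [prod_ite]
            simp [hI]
  refine (card_le_mul_card_image (f := F) U ((2 * R + 1) ^ k) ?_).trans
    (Nat.mul_le_mul_left _ himage)
  intro z hz
  obtain ⟨a₀, ha₀, rfl⟩ := mem_image.mp hz
  have hsub : {a ∈ U | F a = F a₀} ⊆
      Fintype.piFinset fun i => if i ∈ J then Icc (a₀ i - R) (a₀ i + R) else {a₀ i} := by
    intro a ha
    obtain ⟨haU, haF⟩ := mem_filter.mp ha
    obtain ⟨haT, hab⟩ := mem_filter.mp haU
    obtain ⟨ha₀T, ha₀b⟩ := mem_filter.mp ha₀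
    have hoff : ∀ i, i ∉ J → a i = a₀ i := by
      intro i hi
      simpa [F, hi] using congrFun (congrArg Prod.fst haF) i
    have hfl : ∀ i ∈ I, ⌊θ a i⌋ = ⌊θ a₀ i⌋ := by
      intro i hi
      simpa [F, hi] using congrFun (congrArg Prod.snd haF) i
    have hnear := hR a haT a₀ ha₀T hoff fun i hi =>
      abs_sub_mul_lt_one_of_bin_eq (hfl i hi) ((hab i hi).trans (ha₀b i hi).symm)
    rw [Fintype.mem_piFinset]
    intro i
    by_cases hi : i ∈ J
    · have := abs_le.mp (hnear i)
      simp only [hi, if_true, mem_Icc]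
      omega
    · simpa [hi] using hoff i hi
  refine (card_le_card hsub).trans ?_
  rw [Fintype.card_piFinset]
  calc ∏ i, #(if i ∈ J then Icc (a₀ i - R) (a₀ i + R) else {a₀ i})
      ≤ ∏ i, (if i ∈ J then 2 * R + 1 else 1) := by
        refine prod_le_prod' fun i _ => ?_
        split_ifs
        · rw [Int.card_Icc]; omega
        · simp
    _ ≤ (2 * R + 1) ^ k := by
        rw [prod_ite]
        simp [hJ]

/-- An average of products of exponential sums is controlled by the sizes of the fibres over
the bins of `k` of the frequencies. -/
lemma sum_prod_expSum_le {d k B : ℕ} (hB : 0 < B) {I : Finset (Fin d)} (hI : #I = k)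
    (T : Finset (Fin d → ℤ)) (θ : (Fin d → ℤ) → Fin d → ℝ) (X : ℝ) (hX0 : 0 ≤ X)
    (hX : ∀ j : Fin d → ℕ, (#{a ∈ T | ∀ i ∈ I, bin B (θ a i) = j i} : ℝ) ≤ X) :
    ∑ a ∈ T, ∏ i, ‖expSum B (θ a i)‖ ≤
      (B : ℝ) ^ (d - k) * ((2 * B * (1 + Real.log B)) ^ k * X) := by
  have hw0 : ∀ x : ℝ, 0 ≤ binWeight B (bin B x) := fun x => binWeight_nonneg (bin_lt hB x)
  -- Bin vectors are set to 0 off `I`, so that `P` has one free bin for each index in `I` and the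
  -- sum of weights factors. Indices off `I` get the trivial bound `B`.
  let P : Finset (Fin d → ℕ) := Fintype.piFinset fun i => if i ∈ I then range B else {0}
  let J : (Fin d → ℤ) → Fin d → ℕ := fun a i => if i ∈ I then bin B (θ a i) else 0
  have hJP : ∀ a ∈ T, J a ∈ P := by
    intro a _
    rw [Fintype.mem_piFinset]
    intro i
    by_cases hi : i ∈ I
    · simpa [J, hi] using bin_lt hB _
    · simp [J, hi]
  calc ∑ a ∈ T, ∏ i, ‖expSum B (θ a i)‖
      ≤ ∑ a ∈ T, (B : ℝ) ^ (d - k) * ∏ i ∈ I, binWeight B (bin B (θ a i)) := by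
        refine sum_le_sum fun a _ => ?_
        rw [← prod_compl_mul_prod I]
        refine mul_le_mul ?_ ?_ (prod_nonneg fun _ _ => norm_nonneg _) (by positivity)
        · calc ∏ i ∈ Iᶜ, ‖expSum B (θ a i)‖ ≤ ∏ _i ∈ Iᶜ, (B : ℝ) :=
              prod_le_prod (fun _ _ => norm_nonneg _) fun _ _ => norm_expSum_le _ _
            _ = (B : ℝ) ^ (d - k) := by simp [card_compl, hI]
        · exact prod_le_prod (fun _ _ => norm_nonneg _) fun _ _ => norm_expSum_le_binWeight hB _
    _ = (B : ℝ) ^ (d - k) * ∑ j ∈ P, ∑ a ∈ T with J a = j,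
          ∏ i ∈ I, binWeight B (bin B (θ a i)) := by
        rw [← mul_sum, sum_fiberwise_of_maps_to hJP]
    _ ≤ (B : ℝ) ^ (d - k) * ∑ j ∈ P, X * ∏ i ∈ I, binWeight B (j i) := by
        refine mul_le_mul_of_nonneg_left (sum_le_sum fun j hj => ?_) (by positivity)
        have hjb : ∀ a, J a = j → ∀ i ∈ I, bin B (θ a i) = j i := by
          rintro a rfl i hi
          simp [J, hi]
        calc ∑ a ∈ T with J a = j, ∏ i ∈ I, binWeight B (bin B (θ a i))
            = ∑ a ∈ T with J a = j, ∏ i ∈ I, binWeight B (j i) := by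
              refine sum_congr rfl fun a ha => prod_congr rfl fun i hi => ?_
              rw [hjb a (mem_filter.mp ha).2 i hi]
          _ = #{a ∈ T | J a = j} * ∏ i ∈ I, binWeight B (j i) := by simp
          _ ≤ X * ∏ i ∈ I, binWeight B (j i) := by
              refine mul_le_mul_of_nonneg_right ?_ (prod_nonneg fun i hi => ?_)
              · refine le_trans ?_ (hX j)
                exact_mod_cast card_le_card fun a ha => by
                  rw [mem_filter] at ha ⊢
                  exact ⟨ha.1, hjb a ha.2⟩
              · have := Fintype.mem_piFinset.mp hj i
                rw [if_pos hi, mem_range] at this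
                exact binWeight_nonneg this
    _ = (B : ℝ) ^ (d - k) * ((∑ j ∈ range B, binWeight B j) ^ k * X) := by
        rw [← mul_sum, mul_comm X]
        congr 2
        have h1 : ∀ j : Fin d → ℕ, ∏ i ∈ I, binWeight B (j i) =
            ∏ i, if i ∈ I then binWeight B (j i) else 1 := by
          intro j
          rw [prod_ite_mem, univ_inter]
        simp only [h1, P]
        rw [← prod_univ_sum (fun i => if i ∈ I then range B else {0})
          (fun i l => if i ∈ I then binWeight B l else 1)]
        rw [← hI, ← prod_const, ← univ_inter I, ← prod_ite_mem]
        refine prod_congr rfl fun i _ => ?_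
        by_cases hi : i ∈ I <;> simp [hi]
    _ ≤ _ := by
        have := sum_binWeight_le B
        have h0 : 0 ≤ ∑ j ∈ range B, binWeight B j :=
          sum_nonneg fun j hj => binWeight_nonneg (mem_range.mp hj)
        gcongr

/-! ### Boxes of lattice points and clamped base points -/

lemma uniqueDiffOn_Icc_pi {d : ℕ} {lo hi : Fin d → ℝ} (hlt : ∀ i, lo i < hi i) :
    UniqueDiffOn ℝ (Set.Icc lo hi) := by
  rw [← Set.pi_univ_Icc]
  exact UniqueDiffOn.univ_pi fun i => uniqueDiffOn_Icc (hlt i)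

/-- The point `(a + lam) / q`, moved into `{x | lo ≤ x}`. -/
noncomputable def clampedPoint {d : ℕ} (lo : Fin d → ℝ) (q : ℕ) (lam : Fin d → ℝ)
    (a : Fin d → ℤ) : Fin d → ℝ :=
  fun i => max (lo i) ((a i + lam i) / q)

/-- The range of a coordinate of the lattice points in `latticeBox`. -/
noncomputable def latticeInterval {d : ℕ} (lo hi : Fin d → ℝ) (q B : ℕ) (lam : Fin d → ℝ)
    (i : Fin d) : Finset ℤ :=
  Icc ⌈q * lo i - B - lam i⌉ ⌊q * hi i - lam i⌋

/-- The integer points `a` with `q lo - B ≤ a + lam ≤ q hi`. -/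
noncomputable def latticeBox {d : ℕ} (lo hi : Fin d → ℝ) (q B : ℕ) (lam : Fin d → ℝ) :
    Finset (Fin d → ℤ) :=
  Fintype.piFinset (latticeInterval lo hi q B lam)

section Box

variable {d : ℕ} {lo hi lam : Fin d → ℝ} {q B : ℕ} {a : Fin d → ℤ}

lemma mem_latticeBox : a ∈ latticeBox lo hi q B lam ↔
    ∀ i, q * lo i - B ≤ a i + lam i ∧ a i + lam i ≤ q * hi i := by
  simp only [latticeBox, latticeInterval, Fintype.mem_piFinset, mem_Icc, Int.ceil_le, Int.le_floor]
  refine forall_congr' fun i => ?_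
  constructor <;> rintro ⟨h1, h2⟩ <;> constructor <;> linarith

/-- The two extra multiples of `q` absorb the margin `B` and the rounding. -/
lemma card_latticeInterval_le {W : ℕ} (hW : ∀ i, hi i - lo i ≤ W)
    (hq : 0 < q) (hB : B ≤ q) (i : Fin d) :
    #(latticeInterval lo hi q B lam i) ≤ (W + 2) * q := by
  rw [latticeInterval, Int.card_Icc]
  have h1 := Int.floor_le (q * hi i - lam i)
  have h2 := Int.le_ceil (q * lo i - B - lam i)
  have hq' : (1 : ℝ) ≤ q := by exact_mod_cast hq
  have hB' : (B : ℝ) ≤ q := by exact_mod_cast hB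
  have h3 : (q : ℝ) * (hi i - lo i) ≤ q * W := by gcongr; exact hW i
  have h4 : ((⌊q * hi i - lam i⌋ + 1 - ⌈q * lo i - B - lam i⌉ : ℤ) : ℝ) ≤
      (((W + 2) * q : ℕ) : ℤ) := by
    push_cast
    nlinarith
  have h5 : ⌊q * hi i - lam i⌋ + 1 - ⌈q * lo i - B - lam i⌉ ≤ (((W + 2) * q : ℕ) : ℤ) := by
    exact_mod_cast h4
  exact Int.toNat_le.mpr h5

lemma clampedPoint_mem (hq : 0 < q) (hlo : ∀ i, lo i ≤ hi i)
    (ha : a ∈ latticeBox lo hi q B lam) : clampedPoint lo q lam a ∈ Set.Icc lo hi := by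
  have hq' : (0 : ℝ) < q := by exact_mod_cast hq
  refine ⟨fun i => le_max_left _ _, fun i => max_le (hlo i) ?_⟩
  rw [div_le_iff₀ hq', mul_comm]
  exact (mem_latticeBox.mp ha i).2

/-- A box `a + [0, B)ᵈ` meeting the rescaled rectangle may have its corner outside. Clamping brings
the base point back into the domain of `f` at a cost of at most `B`. -/
lemma abs_clampedPoint_sub_le (hq : 0 < q) (ha : a ∈ latticeBox lo hi q B lam) (i : Fin d) :
    0 ≤ q * clampedPoint lo q lam a i - (a i + lam i) ∧
      q * clampedPoint lo q lam a i - (a i + lam i) ≤ B := by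
  have hq' : (0 : ℝ) < q := by exact_mod_cast hq
  have h := (mem_latticeBox.mp ha i).1
  rw [clampedPoint, mul_max_of_nonneg _ _ hq'.le, mul_div_cancel₀ _ hq'.ne']
  constructor
  · linarith [le_max_right (q * lo i) (a i + lam i)]
  · have : max (q * lo i) (a i + lam i) ≤ B + (a i + lam i) :=
      max_le (by linarith) (by linarith [(Nat.cast_nonneg B : (0 : ℝ) ≤ B)])
    linarith

end Box

/-! ### The average over base points -/

/-- The main estimate: averages of products of exponential sums whose frequencies are the
partial derivatives of `h · f`. -/
lemma exists_sum_prod_expSum_grad_le {d m k : ℕ} (hk : 0 < k)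
    {lo hi : Fin d → ℝ} (hlt : ∀ i, lo i < hi i)
    {f : (Fin d → ℝ) → (Fin m → ℝ)} (hf : ContDiffOn ℝ 2 f (Set.Icc lo hi))
    (hrank : ∀ α ∈ Set.Icc lo hi, ∀ t : Fin m → ℝ, t ≠ 0 →
      k ≤ (hessian (Set.Icc lo hi) f α t).rank) :
    ∃ C : ℝ, 0 ≤ C ∧ ∀ (q B : ℕ) (lam : Fin d → ℝ) (h : Fin m → ℝ), 0 < q → 0 < B → B ≤ q →
      1 ≤ ‖h‖ → (B : ℝ) ^ 2 * ‖h‖ ≤ q →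
      (∑ a ∈ latticeBox lo hi q B lam, ∏ i, ‖expSum B
        (grad (Set.Icc lo hi) f h (clampedPoint lo q lam a) i)‖) * (B : ℝ) ^ k ≤
        C * ((q : ℝ) ^ d * (B : ℝ) ^ d * (1 + Real.log B) ^ k) := by
  set K := Set.Icc lo hi with hK
  have hle : ∀ i, lo i ≤ hi i := fun i => (hlt i).le
  have hconv : Convex ℝ K := convex_Icc lo hi
  have hcpt : IsCompact K := isCompact_Icc
  have hud : UniqueDiffOn ℝ K := uniqueDiffOn_Icc_pi hlt
  obtain ⟨c, r, hc, hr, hgrad⟩ := exists_gradient_lower_bound hk hud hconv hcpt hf hrank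
  obtain ⟨L, hL1, hL, -⟩ := exists_taylor_bound hud hconv hcpt hf
  obtain ⟨t, htK, htfin, htcov⟩ := hcpt.finite_cover_balls hr
  lift t to Finset (Fin d → ℝ) using htfin
  obtain ⟨W, hW⟩ : ∃ W : ℕ, ∀ i, hi i - lo i ≤ W := by
    obtain ⟨W, hW⟩ := exists_nat_ge ‖hi - lo‖
    exact ⟨W, fun i => (le_abs_self _).trans ((norm_le_pi_norm (hi - lo) i).trans hW)⟩
  set A₁ : ℝ := (W + 2 : ℝ) ^ (d - k) with hA₁
  set A₂ : ℝ := (2 * (m * L) + 3) ^ k with hA₂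
  set A₃ : ℝ := (2 / c + 3) ^ k with hA₃
  refine ⟨#t * (2 ^ k * (A₃ * (A₁ * A₂))), by positivity, ?_⟩
  intro q B lam h hq hB hBq hh hBh
  have hq' : (0 : ℝ) < q := by exact_mod_cast hq
  have hB' : (0 : ℝ) < B := by exact_mod_cast hB
  have hB1 : (1 : ℝ) ≤ B := by exact_mod_cast hB
  have hh0 : (0 : ℝ) < ‖h‖ := by linarith
  have hhne : h ≠ 0 := norm_pos_iff.mp hh0
  set x := clampedPoint lo q lam with hx
  set Λ := latticeBox lo hi q B lam with hΛ
  set F : (Fin d → ℤ) → ℝ := fun a => ∏ i, ‖expSum B (grad K f h (x a) i)‖ with hF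
  have hxK : ∀ a ∈ Λ, x a ∈ K := fun a ha => clampedPoint_mem hq hle ha
  have hF0 : ∀ a, 0 ≤ F a := fun a => prod_nonneg fun _ _ => norm_nonneg _
  have hcover : ∑ a ∈ Λ, F a ≤ ∑ p ∈ t, ∑ a ∈ Λ with ‖x a - p‖ < r, F a := by
    simp only [sum_filter]
    rw [sum_comm]
    refine sum_le_sum fun a ha => ?_
    obtain ⟨p, hp, hap⟩ := Set.mem_iUnion₂.mp (htcov (hxK a ha))
    rw [mem_ball_iff_norm] at hap
    calc F a = if ‖x a - p‖ < r then F a else 0 := by rw [if_pos hap]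
      _ ≤ _ := single_le_sum (f := fun p => if ‖x a - p‖ < r then F a else 0)
        (fun p _ => by split_ifs; exacts [hF0 a, le_rfl]) hp
  have hpatch : ∀ p ∈ t, (∑ a ∈ Λ with ‖x a - p‖ < r, F a) * (B : ℝ) ^ k ≤
      (2 ^ k * (A₃ * (A₁ * A₂))) * ((q : ℝ) ^ d * (B : ℝ) ^ d * (1 + Real.log B) ^ k) := by
    intro p hp
    obtain ⟨I, J, hI, hJ, hIJ⟩ := hgrad p (htK hp) h hhne
    have hkd : k ≤ d := by
      rw [← hI]
      exact (card_le_univ I).trans (by simp)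
    set Θ : ℕ := ⌈m * ‖h‖ * L⌉₊ with hΘ
    -- Frequencies within `1/B` force clamped points within `1/(c‖h‖B)`; rescale by `q` and add `B`
    -- for the clamping.
    set R : ℕ := ⌊q / (c * ‖h‖ * B) + B⌋₊ with hRdef
    set T := {a ∈ Λ | ‖x a - p‖ < r} with hT
    have hTΛ : ∀ a ∈ T, a ∈ Λ := fun a ha => (mem_filter.mp ha).1
    have hcount : ∀ j : Fin d → ℕ,
        #{a ∈ T | ∀ i ∈ I, bin B (grad K f h (x a) i) = j i} ≤
          (2 * R + 1) ^ k * (((W + 2) * q) ^ (d - k) * (2 * Θ + 1) ^ k) := by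
      refine card_bin_fiber_le hI hJ (latticeInterval lo hi q B lam)
        (card_latticeInterval_le hW hq hBq) T (filter_subset _ _)
        (fun a => grad K f h (x a)) ?_ ?_
      · intro a ha i _
        refine le_trans ?_ (Nat.le_ceil _)
        refine (abs_dotProduct_le _ _).trans ?_
        gcongr
        refine (ContinuousLinearMap.le_opNorm _ _).trans ?_
        rw [Pi.norm_single, norm_one, mul_one]
        exact hL _ (hxK a (hTΛ a ha))
      · intro a ha a' ha' hoff hnear i
        obtain ⟨l, hl, hlow⟩ := hIJ (x a) (hxK a (hTΛ a ha)) (x a') (hxK a' (hTΛ a' ha'))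
          (mem_filter.mp ha).2 (mem_filter.mp ha').2
          -- Clamping acts coordinatewise, so it preserves agreement off `J`.
          (fun i hi => by simp [hx, clampedPoint, hoff i hi])
        have h1 : c * ‖h‖ * ‖x a - x a'‖ * B < 1 :=
          (mul_le_mul_of_nonneg_right hlow hB'.le).trans_lt (hnear l hl)
        have h2 : |x a i - x a' i| ≤ ‖x a - x a'‖ := norm_le_pi_norm (x a - x a') i
        have h3 : q * |x a i - x a' i| ≤ q / (c * ‖h‖ * B) := by
          rw [le_div_iff₀ (by positivity)]
          have : |x a i - x a' i| * (c * ‖h‖ * B) ≤ 1 := by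
            calc |x a i - x a' i| * (c * ‖h‖ * B) ≤ ‖x a - x a'‖ * (c * ‖h‖ * B) := by gcongr
              _ ≤ 1 := by linarith
          nlinarith
        obtain ⟨h4, h5⟩ := abs_clampedPoint_sub_le hq (hTΛ a ha) i
        obtain ⟨h6, h7⟩ := abs_clampedPoint_sub_le hq (hTΛ a' ha') i
        rw [← hx] at h4 h5 h6 h7
        have h8 : |((a i - a' i : ℤ) : ℝ)| ≤ q / (c * ‖h‖ * B) + B := by
          rw [← abs_of_pos hq', ← abs_mul, abs_of_pos hq', abs_le] at h3
          push_cast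
          rw [abs_le]
          constructor <;> linarith [h3.1, h3.2]
        have h9 : ((|a i - a' i|).toNat : ℝ) ≤ q / (c * ‖h‖ * B) + B := by
          have : (((|a i - a' i|).toNat : ℤ) : ℝ) = |((a i - a' i : ℤ) : ℝ)| := by
            rw [Int.toNat_of_nonneg (abs_nonneg _), Int.cast_abs]
          rw [← this] at h8
          exact_mod_cast h8
        have h10 : (|a i - a' i|).toNat ≤ R := Nat.le_floor h9
        omega
    have hX : ∀ j : Fin d → ℕ,
        (#{a ∈ T | ∀ i ∈ I, bin B (grad K f h (x a) i) = j i} : ℝ) ≤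
          A₃ * (A₁ * A₂) * (q ^ d / B ^ k) := by
      intro j
      have hΘle : (2 * Θ + 1 : ℝ) ≤ (2 * (m * L) + 3) * ‖h‖ := by
        have : (Θ : ℝ) < m * ‖h‖ * L + 1 := Nat.ceil_lt_add_one (by positivity)
        nlinarith
      -- The clamping error does not exceed the order of the main term of `R`.
      have hBle : (B : ℝ) ≤ q / (B * ‖h‖) := by
        rw [le_div_iff₀ (by positivity)]
        calc (B : ℝ) * (B * ‖h‖) = (B : ℝ) ^ 2 * ‖h‖ := by ring
          _ ≤ q := hBh
      have hRle : (2 * R + 1 : ℝ) ≤ (2 / c + 3) * (q / (B * ‖h‖)) := by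
        have h1 : (R : ℝ) ≤ q / (c * ‖h‖ * B) + B := Nat.floor_le (by positivity)
        have h2 : q / (c * ‖h‖ * B) = 1 / c * (q / (B * ‖h‖)) := by field_simp
        have h3 : (2 / c + 3) * (q / (B * ‖h‖)) =
          2 * (1 / c * (q / (B * ‖h‖))) + 3 * (q / (B * ‖h‖)) := by ring
        rw [h3, ← h2]
        linarith
      calc (#{a ∈ T | ∀ i ∈ I, bin B (grad K f h (x a) i) = j i} : ℝ)
          ≤ (2 * R + 1) ^ k * (((W + 2) * q) ^ (d - k) * (2 * Θ + 1) ^ k) := by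
            exact_mod_cast hcount j
        _ ≤ ((2 / c + 3) * (q / (B * ‖h‖))) ^ k *
            (((W + 2) * q) ^ (d - k) * ((2 * (m * L) + 3) * ‖h‖) ^ k) := by gcongr
        -- The `‖h‖ ^ k` from the integer parts cancels the `‖h‖ ^ k` gained in `R`, so the bound is
        -- uniform in `h`.
        _ = A₃ * (A₁ * A₂) * ((q ^ (d - k) * q ^ k) / B ^ k) := by
            rw [hA₁, hA₂, hA₃]
            simp only [mul_pow, div_pow]
            field_simp
        _ = A₃ * (A₁ * A₂) * (q ^ d / B ^ k) := by
            rw [← pow_add, Nat.sub_add_cancel hkd]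
    have hsum := sum_prod_expSum_le hB hI T (fun a => grad K f h (x a)) _ (by positivity) hX
    calc (∑ a ∈ T, F a) * (B : ℝ) ^ k
        ≤ ((B : ℝ) ^ (d - k) * ((2 * B * (1 + Real.log B)) ^ k *
          (A₃ * (A₁ * A₂) * (q ^ d / B ^ k)))) * (B : ℝ) ^ k := by gcongr
      _ = (2 ^ k * (A₃ * (A₁ * A₂))) *
          ((q : ℝ) ^ d * ((B : ℝ) ^ (d - k) * (B : ℝ) ^ k) * (1 + Real.log B) ^ k) := by
          simp only [mul_pow]
          field_simp
      _ = _ := by rw [← pow_add, Nat.sub_add_cancel hkd]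
  calc (∑ a ∈ Λ, F a) * (B : ℝ) ^ k
      ≤ (∑ p ∈ t, ∑ a ∈ Λ with ‖x a - p‖ < r, F a) * (B : ℝ) ^ k := by gcongr
    _ = ∑ p ∈ t, (∑ a ∈ Λ with ‖x a - p‖ < r, F a) * (B : ℝ) ^ k := sum_mul _ _ _
    _ ≤ ∑ p ∈ t, (2 ^ k * (A₃ * (A₁ * A₂))) *
          ((q : ℝ) ^ d * (B : ℝ) ^ d * (1 + Real.log B) ^ k) := sum_le_sum hpatch
    _ = _ := by rw [sum_const, nsmul_eq_mul]; ring

/-! ### From rational points to exponential sums -/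

section Counting

variable {d m : ℕ} {lo hi : Fin d → ℝ} {f : (Fin d → ℝ) → (Fin m → ℝ)} {q : ℕ} {κ : ℝ}
  {θ : (Fin d → ℝ) × (Fin m → ℝ)}

lemma countingSet_mono {κ' : ℝ} (h : κ ≤ κ') (K : Set (Fin d → ℝ)) :
    countingSet K f q κ θ ⊆ countingSet K f q κ' θ := by
  rintro p ⟨h1, h2⟩
  exact ⟨h1, h2.trans_le (by gcongr)⟩

lemma mem_latticeBox_of_mem_Icc (hq : 0 < q) {lam : Fin d → ℝ} {a : Fin d → ℤ}
    (h : (fun i => ((a i : ℝ) + lam i) / (q : ℝ)) ∈ Set.Icc lo hi) :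
    a ∈ latticeBox lo hi q 0 lam := by
  have hq' : (0 : ℝ) < q := by exact_mod_cast hq
  rw [mem_latticeBox]
  intro i
  have h1 := h.1 i
  have h2 := h.2 i
  simp only at h1 h2
  rw [le_div_iff₀ hq'] at h1
  rw [div_le_iff₀ hq'] at h2
  push_cast
  constructor <;> linarith

lemma abs_sub_lt_of_mem_countingSet (hq : 0 < q) {K : Set (Fin d → ℝ)}
    {p : (Fin d → ℤ) × (Fin m → ℤ)} (h : p ∈ countingSet K f q κ θ) (j : Fin m) :
    |q * f (fun i => ((p.1 i : ℝ) + θ.1 i) / (q : ℝ)) j - θ.2 j - p.2 j| < κ := by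
  have hq' : (0 : ℝ) < q := by exact_mod_cast hq
  have h1 := (norm_le_pi_norm _ j).trans_lt h.2
  rw [Pi.sub_apply, Real.norm_eq_abs, lt_div_iff₀ hq'] at h1
  refine lt_of_eq_of_lt ?_ h1
  set v := f (fun i => ((p.1 i : ℝ) + θ.1 i) / (q : ℝ)) j
  have h2 : q * v - θ.2 j - p.2 j = (v - ((p.2 j : ℝ) + θ.2 j) / q) * q := by
    field_simp
    ring
  rw [h2, abs_mul, abs_of_pos hq']

lemma card_latticeBox_le {B W : ℕ} (hW : ∀ i, hi i - lo i ≤ W) (hq : 0 < q) (hB : B ≤ q)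
    (lam : Fin d → ℝ) : (#(latticeBox lo hi q B lam) : ℝ) ≤ (W + 2) ^ d * q ^ d := by
  rw [← mul_pow, latticeBox, Fintype.card_piFinset]
  push_cast
  calc ∏ i, (#(latticeInterval lo hi q B lam i) : ℝ) ≤ ∏ _i : Fin d, ((W + 2) * q : ℝ) :=
        prod_le_prod (fun _ _ => Nat.cast_nonneg _) fun i _ => by
          exact_mod_cast card_latticeInterval_le hW hq hB i
    _ = _ := by simp

/-- The trivial bound for the number of points. -/
lemma countingSet_finite_and_ncard_le {W : ℕ} (hW : ∀ i, hi i - lo i ≤ W) (hq : 0 < q)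
    (hκ : 0 < κ) : (countingSet (Set.Icc lo hi) f q κ θ).Finite ∧
      ((countingSet (Set.Icc lo hi) f q κ θ).ncard : ℝ) ≤
        (W + 2) ^ d * q ^ d * (2 * κ + 1) ^ m := by
  let c : (Fin d → ℤ) → Fin m → ℝ := fun a j =>
    q * f (fun i => ((a i : ℝ) + θ.1 i) / (q : ℝ)) j - θ.2 j
  let V : (Fin d → ℤ) → Finset (Fin m → ℤ) := fun a =>
    Fintype.piFinset fun j => Icc ⌈c a j - κ⌉ ⌊c a j + κ⌋
  let U : Finset ((Fin d → ℤ) × (Fin m → ℤ)) :=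
    (latticeBox lo hi q 0 θ.1).biUnion fun a => {a} ×ˢ V a
  have hsub : countingSet (Set.Icc lo hi) f q κ θ ⊆ U := by
    rintro ⟨a, b⟩ hp
    simp only [U, coe_biUnion, Set.mem_iUnion₂]
    refine ⟨a, mem_latticeBox_of_mem_Icc hq hp.1, ?_⟩
    simp only [mem_coe, mem_product, mem_singleton, true_and]
    rw [Fintype.mem_piFinset]
    intro j
    have := abs_lt.mp (abs_sub_lt_of_mem_countingSet hq hp j)
    rw [mem_Icc, Int.ceil_le, Int.le_floor]
    constructor <;> simp only [c] at this ⊢ <;> linarith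
  refine ⟨U.finite_toSet.subset hsub, ?_⟩
  have hV : ∀ a, (#(V a) : ℝ) ≤ (2 * κ + 1) ^ m := by
    intro a
    rw [Fintype.card_piFinset]
    push_cast
    calc ∏ j, (#(Icc ⌈c a j - κ⌉ ⌊c a j + κ⌋) : ℝ) ≤ ∏ _j : Fin m, (2 * κ + 1) := by
          refine prod_le_prod (fun _ _ => Nat.cast_nonneg _) fun j _ => ?_
          rw [Int.card_Icc]
          have h1 := Int.floor_le (c a j + κ)
          have h2 := Int.le_ceil (c a j - κ)
          have : (((⌊c a j + κ⌋ + 1 - ⌈c a j - κ⌉).toNat : ℤ) : ℝ) =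
              ((max (⌊c a j + κ⌋ + 1 - ⌈c a j - κ⌉) 0 : ℤ) : ℝ) := by
            rw [Int.toNat_eq_max]
          rw [Int.cast_natCast] at this
          rw [this]
          push_cast
          exact max_le (by linarith) (by linarith)
      _ = _ := by simp
  calc ((countingSet (Set.Icc lo hi) f q κ θ).ncard : ℝ) ≤ #U := by
        rw [← Set.ncard_coe_finset]
        exact_mod_cast Set.ncard_le_ncard hsub U.finite_toSet
    _ ≤ ∑ a ∈ latticeBox lo hi q 0 θ.1, (#({a} ×ˢ V a) : ℝ) := by
        exact_mod_cast card_biUnion_le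
    _ ≤ ∑ a ∈ latticeBox lo hi q 0 θ.1, (2 * κ + 1) ^ m := by
        refine sum_le_sum fun a _ => ?_
        rw [card_product, card_singleton, one_mul]
        exact hV a
    _ = #(latticeBox lo hi q 0 θ.1) * (2 * κ + 1) ^ m := by rw [sum_const, nsmul_eq_mul]
    _ ≤ _ := by
        gcongr
        exact card_latticeBox_le hW hq (Nat.zero_le _) _

/-- Linearization of `f` near a clamped base point. -/
lemma affine_near_int_of_mem_countingSet {L : ℝ} {B : ℕ} (hq : 0 < q) (hle : ∀ i, lo i ≤ hi i)
    (hL : ∀ x ∈ Set.Icc lo hi, ∀ y ∈ Set.Icc lo hi,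
      ‖f y - f x - fderivWithin ℝ f (Set.Icc lo hi) x (y - x)‖ ≤ L * ‖y - x‖ ^ 2)
    (hL0 : 0 ≤ L) (hBκ : (B : ℝ) ^ 2 ≤ κ * q) {a a' : Fin d → ℤ} {b : Fin m → ℤ}
    {y : Fin d → ℕ} (ha : a ∈ latticeBox lo hi q B θ.1) (hy : y ∈ cube d B)
    (ha' : ∀ i, a' i = a i + y i) (h : (a', b) ∈ countingSet (Set.Icc lo hi) f q κ θ)
    (j : Fin m) :
    |(q * f (clampedPoint lo q θ.1 a) j - θ.2 j +
        fderivWithin ℝ f (Set.Icc lo hi) (clampedPoint lo q θ.1 a)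
          (fun i => a i + θ.1 i - q * clampedPoint lo q θ.1 a i) j) +
      ∑ i, fderivWithin ℝ f (Set.Icc lo hi) (clampedPoint lo q θ.1 a) (Pi.single i 1) j * y i
      - b j| ≤ (1 + L) * κ := by
  have hq' : (0 : ℝ) < q := by exact_mod_cast hq
  set x := clampedPoint lo q θ.1 a with hx
  set D := fderivWithin ℝ f (Set.Icc lo hi) x with hD
  set x' : Fin d → ℝ := fun i => ((a' i : ℝ) + θ.1 i) / (q : ℝ) with hx'
  have hxK : x ∈ Set.Icc lo hi := clampedPoint_mem hq hle ha
  have hx'K : x' ∈ Set.Icc lo hi := h.1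
  -- The shift `y i` and the clamping displacement both lie in `[0, B]` and are subtracted, so no
  -- factor 2 is lost.
  have hdist : ‖x' - x‖ ≤ B / q := by
    rw [pi_norm_le_iff_of_nonneg (by positivity)]
    intro i
    rw [Real.norm_eq_abs, le_div_iff₀ hq', ← abs_of_pos hq', ← abs_mul]
    obtain ⟨h1, h2⟩ := abs_clampedPoint_sub_le hq ha i
    have h3 : (y i : ℝ) ≤ B := by
      have := Fintype.mem_piFinset.mp hy i
      rw [mem_range] at this
      exact_mod_cast this.le
    have h4 : (0 : ℝ) ≤ y i := Nat.cast_nonneg _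
    have h5 : (x' - x) i * q = a i + y i + θ.1 i - q * x i := by
      rw [Pi.sub_apply, sub_mul, hx']
      simp only [ha']
      push_cast
      field_simp
    rw [h5, abs_le]
    constructor <;> linarith
  have herr : q * |(f x' - f x - D (x' - x)) j| ≤ L * κ := by
    calc q * |(f x' - f x - D (x' - x)) j| ≤ q * (L * (B / q) ^ 2) := by
          gcongr
          refine (norm_le_pi_norm (f x' - f x - D (x' - x)) j).trans ((hL x hxK x' hx'K).trans ?_)
          gcongr
      _ = L * ((B : ℝ) ^ 2 / q) := by field_simp
      _ ≤ L * κ := by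
          gcongr
          rwa [div_le_iff₀ hq']
  have hb := abs_sub_lt_of_mem_countingSet hq h j
  have hlin : q * D (x' - x) j = D (fun i => a i + θ.1 i - q * x i) j +
      ∑ i, D (Pi.single i 1) j * y i := by
    -- The clamping displacement is independent of `y` and joins the constant term of the affine
    -- map.
    have hsplit : (q : ℝ) • (x' - x) = (fun i => a i + θ.1 i - q * x i) +
        ∑ i, (y i : ℝ) • (Pi.single i 1 : Fin d → ℝ) := by
      ext l
      simp only [Pi.smul_apply, Pi.sub_apply, Pi.add_apply, Finset.sum_apply, smul_eq_mul,
        Pi.single_apply, mul_ite, mul_one, mul_zero, sum_ite_eq, mem_univ, if_true, hx', ha']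
      push_cast
      field_simp
      ring
    have h1 := congrFun (congrArg D hsplit) j
    simp only [map_smul, map_add, map_sum, Pi.smul_apply, Pi.add_apply, Finset.sum_apply,
      smul_eq_mul] at h1
    rw [h1]
    simp only [mul_comm]
  have hrw : (q * f x j - θ.2 j + D (fun i => a i + θ.1 i - q * x i) j) +
      ∑ i, D (Pi.single i 1) j * y i - b j =
      (q * f x' j - θ.2 j - b j) - q * (f x' - f x - D (x' - x)) j := by
    simp only [Pi.sub_apply]
    linarith
  rw [hrw]
  refine (abs_sub _ _).trans ?_
  rw [abs_mul, abs_of_pos hq']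
  linarith

lemma norm_natCast_sub_le {N : ℕ} {n n' : Fin m → ℕ} (hn : n ∈ cube m N) (hn' : n' ∈ cube m N) :
    ‖(fun j => (n j : ℝ) - n' j)‖ ≤ N := by
  rw [pi_norm_le_iff_of_nonneg (by positivity)]
  intro j
  have h1 := Fintype.mem_piFinset.mp hn j
  have h2 := Fintype.mem_piFinset.mp hn' j
  rw [mem_range] at h1 h2
  have h3 : (n j : ℝ) ≤ N := by exact_mod_cast h1.le
  have h4 : (n' j : ℝ) ≤ N := by exact_mod_cast h2.le
  rw [Real.norm_eq_abs, abs_le]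
  constructor <;> linarith [(Nat.cast_nonneg (n j) : (0 : ℝ) ≤ _),
    (Nat.cast_nonneg (n' j) : (0 : ℝ) ≤ _)]

lemma one_le_norm_natCast_sub {n n' : Fin m → ℕ} (h : n ≠ n') :
    1 ≤ ‖(fun j => (n j : ℝ) - n' j)‖ := by
  obtain ⟨j, hj⟩ := Function.ne_iff.mp h
  refine le_trans ?_ (norm_le_pi_norm _ j)
  have : (1 : ℤ) ≤ |(n j : ℤ) - n' j| := Int.one_le_abs (by omega)
  rw [Real.norm_eq_abs]
  exact_mod_cast this

/-- Passage from the counting problem to exponential sums, for small `κ`. -/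
lemma ncard_countingSet_le {k : ℕ} {L C : ℝ} {B N W : ℕ} (hW : ∀ i, hi i - lo i ≤ W)
    (hle : ∀ i, lo i ≤ hi i)
    (hL : ∀ x ∈ Set.Icc lo hi, ∀ y ∈ Set.Icc lo hi,
      ‖f y - f x - fderivWithin ℝ f (Set.Icc lo hi) x (y - x)‖ ≤ L * ‖y - x‖ ^ 2)
    (hL0 : 0 ≤ L) (hC : 0 ≤ C) (hq : 0 < q) (hB : 0 < B) (hN : 0 < N) (hBq : B ≤ q)
    (hsum : ∀ h : Fin m → ℝ, 1 ≤ ‖h‖ → (B : ℝ) ^ 2 * ‖h‖ ≤ q →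
      (∑ a ∈ latticeBox lo hi q B θ.1, ∏ i, ‖expSum B
        (grad (Set.Icc lo hi) f h (clampedPoint lo q θ.1 a) i)‖) * (B : ℝ) ^ k ≤
        C * ((q : ℝ) ^ d * (B : ℝ) ^ d * (1 + Real.log B) ^ k))
    (hκ : 0 < κ) (hBκ : (B : ℝ) ^ 2 ≤ κ * q) (hN8 : (1 + L) * κ * (8 * N) ≤ 1) :
    ((countingSet (Set.Icc lo hi) f q κ θ).ncard : ℝ) ≤
      2 ^ m * (q : ℝ) ^ d * ((W + 2) ^ d * (1 / N : ℝ) ^ m + C * ((1 + Real.log B) / B) ^ k) := by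
  classical
  have hq' : (0 : ℝ) < q := by exact_mod_cast hq
  have hB' : (0 : ℝ) < B := by exact_mod_cast hB
  have hN' : (0 : ℝ) < N := by exact_mod_cast hN
  have hN1 : (1 : ℝ) ≤ N := by exact_mod_cast hN
  have hκN : κ * N * 8 ≤ 1 := by
    have : 0 ≤ L * κ * (8 * N) := by positivity
    linarith
  have hκ8 : κ * 8 ≤ 1 := by nlinarith
  set K := Set.Icc lo hi with hK
  set S := countingSet K f q κ θ with hS
  set Λ := latticeBox lo hi q B θ.1 with hΛ
  set x := clampedPoint lo q θ.1 with hx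
  set G := {a ∈ latticeBox lo hi q 0 θ.1 | ∃ b, (a, b) ∈ S} with hG
  -- Each `a` admits at most one `b`, since two would differ by less than `2κ < 1` in every
  -- coordinate.
  have hSG : S.ncard ≤ #G := by
    rw [← Set.ncard_coe_finset]
    refine Set.ncard_le_ncard_of_injOn Prod.fst ?_ ?_ G.finite_toSet
    · rintro ⟨a, b⟩ hp
      exact mem_filter.mpr ⟨mem_latticeBox_of_mem_Icc hq hp.1, b, hp⟩
    · rintro ⟨a, b⟩ hp ⟨a', b'⟩ hp' haa
      obtain rfl : a = a' := haa
      refine Prod.ext rfl (funext fun j => ?_)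
      have h1 := abs_lt.mp (abs_sub_lt_of_mem_countingSet hq hp j)
      have h2 := abs_lt.mp (abs_sub_lt_of_mem_countingSet hq hp' j)
      have h3 : |((b j - b' j : ℤ) : ℝ)| < 1 := by
        push_cast
        simp only at h1 h2
        rw [abs_lt]
        constructor <;> linarith
      have h4 : |b j - b' j| < 1 := by exact_mod_cast h3
      have := Int.abs_lt_one_iff.mp h4
      simp only
      omega
  let Y : (Fin d → ℤ) → Finset (Fin d → ℕ) := fun a => {y ∈ cube d B | (fun i => a i + y i) ∈ G}
  -- Each point of `G` lies in `B ^ d` boxes with corner in `Λ`; for this `Λ` extends by `B` below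
  -- the rectangle.
  have hdouble : (B : ℝ) ^ d * #G ≤ ∑ a ∈ Λ, (#(Y a) : ℝ) := by
    have : ∑ y ∈ cube d B, #G ≤ ∑ y ∈ cube d B, #{a ∈ Λ | (fun i => a i + (y i : ℤ)) ∈ G} := by
      refine sum_le_sum fun y hy => ?_
      refine card_le_card_of_injOn (fun a' i => a' i - (y i : ℤ)) ?_ ?_
      · intro a' ha'
        rw [mem_coe] at ha' ⊢
        rw [mem_filter]
        refine ⟨?_, by simpa using ha'⟩
        rw [hΛ, mem_latticeBox]
        intro i
        have h1 := mem_latticeBox.mp (mem_filter.mp ha').1 i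
        have h2 := Fintype.mem_piFinset.mp hy i
        rw [mem_range] at h2
        have h3 : (y i : ℝ) ≤ B := by exact_mod_cast h2.le
        have h4 : (0 : ℝ) ≤ y i := Nat.cast_nonneg _
        push_cast at h1 ⊢
        constructor <;> linarith [h1.1, h1.2]
      · intro a' _ a'' _ haa
        ext i
        have := congrFun haa i
        simp only at this
        omega
    rw [sum_const, card_cube, smul_eq_mul] at this
    have hcomm : ∑ y ∈ cube d B, #{a ∈ Λ | (fun i => a i + (y i : ℤ)) ∈ G} = ∑ a ∈ Λ, #(Y a) := by
      simp only [Y, card_filter]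
      exact sum_comm
    rw [hcomm] at this
    exact_mod_cast this
  have hY : ∀ a ∈ Λ, (#(Y a) : ℝ) * ((N : ℝ) ^ 2 / 2) ^ m ≤
      ∑ n ∈ cube m N, ∑ n' ∈ cube m N,
        ∏ i, ‖expSum B (grad K f (fun j => (n j : ℝ) - n' j) (x a) i)‖ := by
    intro a ha
    refine card_affine_near_int_le (Y a) (filter_subset _ _)
      (fun j => q * f (x a) j - θ.2 j +
        fderivWithin ℝ f K (x a) (fun i => a i + θ.1 i - q * x a i) j)
      (fun j i => fderivWithin ℝ f K (x a) (Pi.single i 1) j) ?_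
    intro y hy j
    obtain ⟨hyc, hyG⟩ := mem_filter.mp hy
    obtain ⟨b, hb⟩ := (mem_filter.mp hyG).2
    refine ⟨b j, ?_⟩
    have := affine_near_int_of_mem_countingSet hq hle hL hL0 hBκ ha hyc (fun i => rfl) hb j
    calc _ ≤ (1 + L) * κ * (8 * N) := by gcongr
      _ ≤ 1 := hN8
  set D : ℝ := (W + 2) ^ d * q ^ d * (B : ℝ) ^ d with hD
  set E : ℝ := C * ((q : ℝ) ^ d * (B : ℝ) ^ d * (1 + Real.log B) ^ k) / (B : ℝ) ^ k with hE
  have hlog : 0 ≤ Real.log B := Real.log_natCast_nonneg B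
  have hE0 : 0 ≤ E := by positivity
  -- On the diagonal all frequencies vanish and the trivial bound is used. Off it `hsum` applies,
  -- because `B² ‖h‖ ≤ κqN ≤ q`.
  have hpair : ∀ n ∈ cube m N, ∀ n' ∈ cube m N,
      ∑ a ∈ Λ, ∏ i, ‖expSum B (grad K f (fun j => (n j : ℝ) - n' j) (x a) i)‖ ≤
        (if n = n' then D else 0) + E := by
    intro n hn n' hn'
    by_cases hnn : n = n'
    · subst hnn
      have h0 : ∀ a, ∏ i, ‖expSum B (grad K f (fun j => (n j : ℝ) - n j) (x a) i)‖ =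
          (B : ℝ) ^ d := by
        intro a
        have : ∀ i, grad K f (fun j => (n j : ℝ) - n j) (x a) i = 0 := by
          intro i
          simp [grad, dotProduct]
        simp only [this, expSum_zero, Complex.norm_natCast, prod_const, card_univ, Fintype.card_fin]
      simp only [h0, sum_const, nsmul_eq_mul, if_true]
      have := card_latticeBox_le hW hq hBq θ.1
      calc (#Λ : ℝ) * (B : ℝ) ^ d ≤ D := by rw [hD]; gcongr
        _ ≤ D + E := by linarith
    · rw [if_neg hnn, zero_add, hE, le_div_iff₀ (by positivity)]
      refine hsum _ (one_le_norm_natCast_sub hnn) ?_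
      calc (B : ℝ) ^ 2 * ‖(fun j => (n j : ℝ) - n' j)‖ ≤ κ * q * N := by
            gcongr
            exact norm_natCast_sub_le hn hn'
        _ = κ * N * q := by ring
        _ ≤ 1 * q := by
            gcongr
            have : 0 ≤ κ * N := by positivity
            linarith
        _ = q := one_mul _
  have htotal : (B : ℝ) ^ d * #G * ((N : ℝ) ^ 2 / 2) ^ m ≤
      (N : ℝ) ^ m * D + (N : ℝ) ^ m * ((N : ℝ) ^ m * E) := by
    calc (B : ℝ) ^ d * #G * ((N : ℝ) ^ 2 / 2) ^ m
        ≤ (∑ a ∈ Λ, (#(Y a) : ℝ)) * ((N : ℝ) ^ 2 / 2) ^ m := by gcongr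
      _ = ∑ a ∈ Λ, (#(Y a) : ℝ) * ((N : ℝ) ^ 2 / 2) ^ m := sum_mul _ _ _
      _ ≤ ∑ a ∈ Λ, ∑ n ∈ cube m N, ∑ n' ∈ cube m N,
            ∏ i, ‖expSum B (grad K f (fun j => (n j : ℝ) - n' j) (x a) i)‖ := sum_le_sum hY
      _ = ∑ n ∈ cube m N, ∑ n' ∈ cube m N, ∑ a ∈ Λ,
            ∏ i, ‖expSum B (grad K f (fun j => (n j : ℝ) - n' j) (x a) i)‖ := by
          rw [sum_comm]
          exact sum_congr rfl fun n _ => sum_comm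
      _ ≤ ∑ n ∈ cube m N, ∑ n' ∈ cube m N, ((if n = n' then D else 0) + E) :=
          sum_le_sum fun n hn => sum_le_sum fun n' hn' => hpair n hn n' hn'
      _ = ∑ n ∈ cube m N, (D + (N : ℝ) ^ m * E) := by
          refine sum_congr rfl fun n hn => ?_
          rw [sum_add_distrib, sum_ite_eq, if_pos hn, sum_const, card_cube, nsmul_eq_mul]
          push_cast
          rfl
      _ = _ := by
          rw [sum_const, card_cube, nsmul_eq_mul]
          push_cast
          ring
  have hfinal : (#G : ℝ) * ((B : ℝ) ^ d * ((N : ℝ) ^ 2 / 2) ^ m) ≤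
      2 ^ m * (q : ℝ) ^ d * ((W + 2) ^ d * (1 / N : ℝ) ^ m + C * ((1 + Real.log B) / B) ^ k) *
        ((B : ℝ) ^ d * ((N : ℝ) ^ 2 / 2) ^ m) := by
    calc (#G : ℝ) * ((B : ℝ) ^ d * ((N : ℝ) ^ 2 / 2) ^ m)
        = (B : ℝ) ^ d * #G * ((N : ℝ) ^ 2 / 2) ^ m := by ring
      _ ≤ _ := htotal
      _ = _ := by
        rw [hD, hE]
        simp only [div_pow, one_pow]
        field_simp
        ring
  refine le_trans (by exact_mod_cast hSG) (le_of_mul_le_mul_right hfinal (by positivity))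

end Counting

/-! ### Choice of parameters -/

lemma one_le_Log (x : ℝ) : 1 ≤ Log x := le_max_left _ _

lemma phi_nonneg (m k q : ℕ) : 0 ≤ phi m k q := by
  unfold phi
  positivity

lemma phi_pow {m k : ℕ} (hk : 0 < k) (q : ℕ) :
    phi m k q ^ (2 * m + k) = ((q : ℝ)⁻¹ * Log q ^ 2) ^ k := by
  have h0 : 0 ≤ (q : ℝ)⁻¹ * Log q ^ 2 := by positivity
  have hk' : (0 : ℝ) < k := by exact_mod_cast hk
  rw [phi, ← Real.rpow_natCast, ← Real.rpow_mul h0, ← Real.rpow_natCast _ k]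
  congr 1
  push_cast
  field_simp

/-- As `Log ≥ 1` and the exponent of `φ` is at most 1, `φ q ≥ 1/q`. This makes `B = ⌊√(κq)⌋`
positive. -/
lemma one_le_mul_of_phi_le {m k q : ℕ} (hk : 0 < k) (hq : 0 < q) {κ : ℝ}
    (h : phi m k q ≤ κ) : 1 ≤ κ * q := by
  have hq' : (0 : ℝ) < q := by exact_mod_cast hq
  have hq1 : (1 : ℝ) ≤ q := by exact_mod_cast hq
  have hL := one_le_Log q
  have h1 : ((q : ℝ)⁻¹) ^ (2 * m + k) ≤ κ ^ (2 * m + k) := by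
    calc ((q : ℝ)⁻¹) ^ (2 * m + k) ≤ ((q : ℝ)⁻¹) ^ k :=
          pow_le_pow_of_le_one (by positivity) (inv_le_one_of_one_le₀ hq1) (by omega)
      _ ≤ ((q : ℝ)⁻¹ * Log q ^ 2) ^ k := by
          gcongr
          exact le_mul_of_one_le_right (by positivity) (one_le_pow₀ hL)
      _ = phi m k q ^ (2 * m + k) := (phi_pow hk q).symm
      _ ≤ _ := by
          have := phi_nonneg m k q
          gcongr
  have h2 : (q : ℝ)⁻¹ ≤ κ :=
    le_of_pow_le_pow_left₀ (by omega) ((phi_nonneg m k q).trans h) h1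
  calc (1 : ℝ) = (q : ℝ)⁻¹ * q := (inv_mul_cancel₀ hq'.ne').symm
    _ ≤ κ * q := by gcongr

/-- This balance dictates `φ`: squared and cleared of denominators it reads `(q⁻¹ Log² q) ^ k ≤ κ ^
(2m + k)`, with equality at `κ = φ q`. -/
lemma log_div_sqrt_pow_le {m k q : ℕ} (hk : 0 < k) (hq : 0 < q) {κ : ℝ} (hκ : 0 < κ)
    (h : phi m k q ≤ κ) : (Log q / √(κ * q)) ^ k ≤ κ ^ m := by
  have hq' : (0 : ℝ) < q := by exact_mod_cast hq
  have h1 : ((q : ℝ)⁻¹ * Log q ^ 2) ^ k ≤ κ ^ (2 * m + k) := by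
    rw [← phi_pow hk]
    have := phi_nonneg m k q
    gcongr
  refine le_of_pow_le_pow_left₀ two_ne_zero (by positivity) ?_
  calc ((Log q / √(κ * q)) ^ k) ^ 2 = ((q : ℝ)⁻¹ * Log q ^ 2) ^ k / κ ^ k := by
        rw [← pow_mul, mul_comm k 2, pow_mul, div_pow, Real.sq_sqrt (by positivity), ← div_pow]
        congr 1
        field_simp
    _ ≤ κ ^ (2 * m + k) / κ ^ k := by gcongr
    _ = (κ ^ m) ^ 2 := by
        rw [pow_add, mul_div_assoc, div_self (by positivity), mul_one, mul_comm 2 m, pow_mul]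

lemma half_le_floor {x : ℝ} (hx : 1 ≤ x) : x / 2 ≤ ⌊x⌋₊ := by
  have h1 := Nat.lt_floor_add_one x
  have h2 : (1 : ℝ) ≤ ⌊x⌋₊ := by exact_mod_cast Nat.le_floor (by simpa using hx)
  linarith

end RationalPoints

/-! ### Proof of the theorem -/

open RationalPoints in
theorem theorem3p1 (d m k : ℕ) (hd : 0 < d) (hm : 0 < m) (hk : 0 < k)
    (lo hi : Fin d → ℝ) (hlt : ∀ i, lo i < hi i)
    (f : (Fin d → ℝ) → (Fin m → ℝ)) (hf : ContDiffOn ℝ 2 f (Set.Icc lo hi))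
    (hrank : ∀ α ∈ Set.Icc lo hi, ∀ t : Fin m → ℝ, t ≠ 0 →
      k ≤ (RationalPoints.hessian (Set.Icc lo hi) f α t).rank) :
    ∃ C : ℝ, 1 ≤ C ∧ ∀ (q : ℕ) (κ : ℝ) (θ : (Fin d → ℝ) × (Fin m → ℝ)), 0 < q → 0 < κ →
      (RationalPoints.countingSet (Set.Icc lo hi) f q κ θ).Finite ∧
      ((RationalPoints.countingSet (Set.Icc lo hi) f q κ θ).ncard : ℝ) ≤
        C * ((q : ℝ) ^ d * max κ (RationalPoints.phi m k q) ^ m) := by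
  have hle : ∀ i, lo i ≤ hi i := fun i => (hlt i).le
  obtain ⟨C₁, hC₁, hsum⟩ := exists_sum_prod_expSum_grad_le hk hlt hf hrank
  obtain ⟨L, hL1, -, hL⟩ := exists_taylor_bound (uniqueDiffOn_Icc_pi hlt) (convex_Icc lo hi)
    isCompact_Icc hf
  obtain ⟨W, hW⟩ : ∃ W : ℕ, ∀ i, hi i - lo i ≤ W := by
    obtain ⟨W, hW⟩ := exists_nat_ge ‖hi - lo‖
    exact ⟨W, fun i => (le_abs_self _).trans ((norm_le_pi_norm (hi - lo) i).trans hW)⟩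
  -- The condition `(1 + L) * κ * (8 * N) ≤ 1` reads `κ * N ≤ κ₀`, so `κ₀` is the threshold below
  -- which some `N ≥ 1` is allowed.
  set κ₀ : ℝ := 1 / (8 * (1 + L)) with hκ₀
  have hκ₀pos : 0 < κ₀ := by positivity
  have hκ₀le : κ₀ ≤ 1 := by
    rw [hκ₀, div_le_one (by positivity)]
    linarith
  set C₂ : ℝ := (W + 2) ^ d * (2 + 1 / κ₀) ^ m with hC₂
  set C₃ : ℝ := 2 ^ m * ((W + 2) ^ d * (2 / κ₀) ^ m + C₁ * 4 ^ k) with hC₃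
  have hC₂0 : 0 ≤ C₂ := by positivity
  have hC₃0 : 0 ≤ C₃ := by positivity
  refine ⟨1 + C₂ + C₃, by linarith, fun q κ₁ θ hq hκ₁ => ?_⟩
  refine ⟨(countingSet_finite_and_ncard_le hW hq hκ₁).1, ?_⟩
  set κ := max κ₁ (phi m k q) with hκdef
  have hκ : 0 < κ := hκ₁.trans_le (le_max_left _ _)
  have hφ : phi m k q ≤ κ := le_max_right _ _
  obtain ⟨hfin, htriv⟩ := countingSet_finite_and_ncard_le (f := f) (θ := θ) hW hq hκ
  have hmono : ((countingSet (Set.Icc lo hi) f q κ₁ θ).ncard : ℝ) ≤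
      (countingSet (Set.Icc lo hi) f q κ θ).ncard := by
    exact_mod_cast Set.ncard_le_ncard (countingSet_mono (le_max_left _ _) _) hfin
  refine hmono.trans ?_
  have hq' : (0 : ℝ) < q := by exact_mod_cast hq
  have hq1 : (1 : ℝ) ≤ q := by exact_mod_cast hq
  have hqκ0 : 0 ≤ (q : ℝ) ^ d * κ ^ m := by positivity
  rcases le_total κ₀ κ with hcase | hcase
  · have h1 : 2 * κ + 1 ≤ (2 + 1 / κ₀) * κ := by
      have : 1 ≤ 1 / κ₀ * κ := by
        rw [div_mul_eq_mul_div, one_mul, one_le_div hκ₀pos]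
        exact hcase
      linarith
    calc _ ≤ (W + 2 : ℝ) ^ d * q ^ d * (2 * κ + 1) ^ m := htriv
      _ ≤ (W + 2 : ℝ) ^ d * q ^ d * ((2 + 1 / κ₀) * κ) ^ m := by gcongr
      _ = C₂ * ((q : ℝ) ^ d * κ ^ m) := by rw [hC₂, mul_pow]; ring
      _ ≤ _ := by gcongr; linarith
  · have hκq := one_le_mul_of_phi_le hk hq hφ
    have hs1 : 1 ≤ √(κ * q) := Real.one_le_sqrt.mpr hκq
    -- `B` is the largest side with linearization error `O(κ)`, and `N` the largest length that
    -- still detects closeness `(1 + L) * κ`.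
    set B := ⌊√(κ * q)⌋₊ with hB
    set N := ⌊κ₀ / κ⌋₊ with hN
    have hN1 : 1 ≤ κ₀ / κ := (one_le_div hκ).mpr hcase
    have hBpos : 0 < B := Nat.floor_pos.mpr hs1
    have hNpos : 0 < N := Nat.floor_pos.mpr hN1
    have hBle : (B : ℝ) ≤ √(κ * q) := Nat.floor_le (by positivity)
    have hNle : (N : ℝ) ≤ κ₀ / κ := Nat.floor_le (by positivity)
    have hBsq : (B : ℝ) ^ 2 ≤ κ * q := by
      calc (B : ℝ) ^ 2 ≤ √(κ * q) ^ 2 := by gcongr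
        _ = κ * q := Real.sq_sqrt (by positivity)
    have hBq : B ≤ q := by
      have : (B : ℝ) ≤ q := by
        refine hBle.trans (Real.sqrt_le_iff.mpr ⟨hq'.le, ?_⟩)
        nlinarith
      exact_mod_cast this
    have hN8 : (1 + L) * κ * (8 * N) ≤ 1 := by
      calc (1 + L) * κ * (8 * N) ≤ (1 + L) * κ * (8 * (κ₀ / κ)) := by gcongr
        _ = 1 := by rw [hκ₀]; field_simp
    have hmain := ncard_countingSet_le (θ := θ) hW hle hL (by linarith) hC₁ hq hBpos hNpos hBq
      (fun h => hsum q B θ.1 h hq hBpos hBq) hκ hBsq hN8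
    have hNinv : (1 / N : ℝ) ≤ 2 / κ₀ * κ := by
      have h2 := half_le_floor hN1
      calc (1 / N : ℝ) ≤ 1 / (κ₀ / κ / 2) := by gcongr
        _ = 2 / κ₀ * κ := by field_simp
    have hlog0 : 0 ≤ Real.log B := Real.log_natCast_nonneg B
    have hlogB : (1 + Real.log B) / B ≤ 4 * (Log q / √(κ * q)) := by
      have h2 := half_le_floor hs1
      have h3 : Real.log B ≤ Log q := by
        refine le_trans (Real.log_le_log (by exact_mod_cast hBpos) ?_) (le_max_right _ _)
        exact_mod_cast hBq
      have h4 := one_le_Log q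
      calc (1 + Real.log B) / B ≤ (2 * Log q) / (√(κ * q) / 2) := by
            gcongr
            linarith
        _ = 4 * (Log q / √(κ * q)) := by field_simp; norm_num
    calc _ ≤ _ := hmain
      _ ≤ 2 ^ m * (q : ℝ) ^ d * ((W + 2) ^ d * (2 / κ₀ * κ) ^ m +
          C₁ * (4 * (Log q / √(κ * q))) ^ k) := by gcongr
      _ ≤ 2 ^ m * (q : ℝ) ^ d * ((W + 2) ^ d * (2 / κ₀ * κ) ^ m + C₁ * (4 ^ k * κ ^ m)) := by
          rw [mul_pow 4]
          gcongr
          exact log_div_sqrt_pow_le hk hq hκ hφ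
      _ = C₃ * ((q : ℝ) ^ d * κ ^ m) := by rw [hC₃, mul_pow]; ring
      _ ≤ _ := by gcongr; linarith
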